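/- **Conventions.** Rings are associative with $1$. Let $K$ be a commutative ring with involution $k\mapsto\bar k$. A *pseudo-involution* with symmetry $\lambda_R\in R^*$ on a $K$-algebra $R$ is an additive map $r\mapsto\bar r$ with $\bar 1=1$, $\overline{rr'}=\bar r'\,\bar r$, $\bar{\bar r}=\lambda_R r\overline{\lambda_R}$, agreeing with the involution of $K$ on the image of $K$. A *quadratic structure* on $R$ is an abelian group $A_R$ with a right action of the multiplicative monoid of $R$ by additive maps, and additive maps $\phi_R\colon R\to A_R$, $\operatorname{tr}_R\colon A_R\to R$ that are equivariant for the action $r\cdot r'=\bar r'rr'$ on $R$, such that $\phi_R(r)=\phi_R(\bar r\lambda_R)$, $\operatorname{tr}_R(\phi_R(r))=r+\bar r\lambda_R$, $\operatorname{tr}_R(a)=\overline{\operatorname{tr}_R(a)}\lambda_R$ and $a\cdot(r+r')=a\cdot r+\phi_R(\bar r'\operatorname{tr}_R(a)r)+a\cdot r'$. A *quadratic ring* $(K,A_K)$ is a commutative ring $K$ with involution (so $\lambda_K=1$) and a quadratic structure $A_K$ that is itself a commutative ring with $a(a'\cdot k)=aa'\cdot k$, $a\phi_K(k)=\phi_K(\operatorname{tr}_K(a)k)$,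 $\operatorname{tr}_K(1)=1$, $\operatorname{tr}_K(aa')=\operatorname{tr}_K(a)\operatorname{tr}_K(a')$. A *quadratic algebra* $(R,A_R)$ over $(K,A_K)$ is a $K$-algebra with pseudo-involution and a quadratic structure $A_R$ that is an $A_K$-module with $c(a\cdot r)=ca\cdot r$, $(c\cdot k)a=ca\cdot k$, $c\,\phi_R(r)=\phi_R(\operatorname{tr}_K(c)r)$, $\phi_K(k)a=\phi_R(k\operatorname{tr}_R(a))$, $\operatorname{tr}_R(ca)=\operatorname{tr}_K(c)\operatorname{tr}_R(a)$. A *sesquilinear form* on a right $R$-module $P$ is a biadditive map $B\colon P\times P\to R$ with $B(pr,p'r')=\bar r B(p,p')r'$; it is *nondegenerate* if $P$ is finitely generated projective and $p\mapsto B(p,-)$ is a bijection $P\to\operatorname{Hom}_R(P,R)$. A *quadratic $S$-$R$-bimodule* $(M,B,q)$ over quadratic algebras $(S,A_S)$, $(R,A_R)$ is an $S$-$R$-bimodule $M$ on which the two actions of $K$ coincide, with a sesquilinear form $B$ that is hermitian, i.e. $B(sm,m')=B(m,\bar sm')$ and $B(m,\lambda_Sm')=\overline{B(m',m)}\lambda_R$,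 and a map $q\colon A_S\times M\to A_R$ that is $A_K$-linear in the first argument and satisfies $q(a\cdot s,m)=q(a,sm)$, $q(\phi_S(s),m)=\phi_R(B(m,sm))$, $q(a,mr)=q(a,m)\cdot r$, $q(a,m+m')=q(a,m)+\phi_R(B(m,\operatorname{tr}_S(a)m'))+q(a,m')$, $\operatorname{tr}_R(q(a,m))=B(m,\operatorname{tr}_S(a)m)$. In the bicategory $\mathbf{qbim}_K$ the objects are quadratic algebras over $(K,A_K)$, the morphisms from $R$ to $S$ are quadratic $S$-$R$-bimodules, the $2$-morphisms are isometries (bimodule homomorphisms preserving $B$ and $q$), and the composite of $L$ (a $T$-$S$-bimodule) and $M$ (an $S$-$R$-bimodule) is $L\otimes_SM$ with $B(l\otimes m,l'\otimes m')=B_M(m,B_L(l,l')m')$ and with the quadratic form $q$ determined by $q(a,l\otimes m)=q_M(q_L(a,l),m)$; the identities are the bimodules $R$ with $B(r,r')=\bar rr'$, $q(a,r)=a\cdot r$. An *adjoint equivalence* is an adjunction whose unit and counit are isomorphisms. A right $R$-module is *fully projective* if it is finitely generated projective and $R$ is a direct summand of a finite power of it. **Proposition.** Let $(K,A_K)$ be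 a quadratic ring. 1. Let $(R,A_R)$ be a quadratic algebra over $(K,A_K)$, let $P$ be a finitely generated projective right $R$-module with a nondegenerate sesquilinear form $B_P$, and let $S=\operatorname{End}_R(P)$. Then $S$ has a structure of a quadratic algebra $(S,A_S)$ over $(K,A_K)$ (a pseudo-involution and a quadratic structure) together with a map $q_P\colon A_S\times P\to A_R$ such that $(P,B_P,q_P)$ is a quadratic $S$-$R$-bimodule that has a left adjoint in $\mathbf{qbim}_K$. It is unique up to unique isomorphism: for two such structures $(A_S,q_P)$ and $(A_S',q_P')$ the pseudo-involutions on $S$ (with their symmetries) coincide, and there is a unique isomorphism $A_S\cong A_S'$ of quadratic structures (commuting with the actions of $S$ and $A_K$ and with $\phi$ and $\operatorname{tr}$) that carries $q_P$ to $q_P'$. 2. All adjoint equivalences in $\mathbf{qbim}_K$ are obtained in this way up to unique isomorphism. That is, if $(Q,P)$ is an adjoint equivalence between quadratic algebras $(S,A_S)$ and $(R,A_R)$, where $P$ is a quadratic $S$-$R$-bimodule and $Q$ is its left adjoint, then $P$ is a fully projective right $R$-module and $B_P$ is nondegenerate; and for every structure on $\operatorname{End}_R(P)$ as in part 1 for $(P,B_P)$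 and every left adjoint $Q'$ of the resulting quadratic $\operatorname{End}_R(P)$-$R$-bimodule $P$ (with unit and counit), the adjunction $(Q',P)$ is an adjoint equivalence and there is a unique isomorphism from $(Q,P)$ to $(Q',P)$ that is the identity on the underlying set of $P$. Here an isomorphism consists of an isomorphism $(S,A_S)\cong(\operatorname{End}_R(P),A_{\operatorname{End}_R(P)})$ of quadratic algebras over $(K,A_K)$ and of isomorphisms of quadratic bimodules over it, for $P$ and for $Q\cong Q'$, commuting with the units and the counits. -/

import Mathlib

open MulOpposite CategoryTheory
open scoped TensorProduct

universe u v w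

/-! ### Pseudo-involutions, quadratic structures, quadratic rings and quadratic algebras -/

/-- A pseudo-involution with symmetry `lam` on a `K`-algebra `R`, where `K` is a commutative ring
with involution. -/
@[ext]
structure PseudoInvolution (K : Type*) (R : Type*) [CommRing K] [StarRing K] [Ring R]
    [Algebra K R] where
  bar : R →+ R
  lam : Rˣ
  bar_one : bar 1 = 1
  bar_mul : ∀ r r' : R, bar (r * r') = bar r' * bar r
  bar_bar : ∀ r : R, bar (bar r) = lam * r * bar lam
  bar_algebraMap : ∀ k : K, bar (algebraMap K R k) = algebraMap K R (star k)

/-- The involution of `K`, as a pseudo-involution with symmetry `1`. -/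
def PseudoInvolution.ofStar (K : Type*) [CommRing K] [StarRing K] : PseudoInvolution K K where
  bar := starAddEquiv.toAddMonoidHom
  lam := 1
  bar_one := by simp
  bar_mul r s := by simp [mul_comm]
  bar_bar r := by simp
  bar_algebraMap k := rfl

/-- A quadratic structure on a ring with pseudo-involution: an abelian group `A` with a right action
of the multiplicative monoid of `R` by additive maps, and equivariant additive maps
`phi : R → A` and `tr : A → R`, where `r'` acts on `R` by `r ↦ bar r' * r * r'`. -/
structure QuadraticStructure {K : Type*} {R : Type*} [CommRing K] [StarRing K] [Ring R]
    [Algebra K R] (σ : PseudoInvolution K R) (A : Type*) [AddCommGroup A] where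
  act : A → R → A
  add_act : ∀ (a a' : A) (r : R), act (a + a') r = act a r + act a' r
  act_one : ∀ a : A, act a 1 = a
  act_mul : ∀ (a : A) (r r' : R), act a (r * r') = act (act a r) r'
  phi : R →+ A
  tr : A →+ R
  phi_act : ∀ r r' : R, phi (σ.bar r' * r * r') = act (phi r) r'
  tr_act : ∀ (a : A) (r : R), tr (act a r) = σ.bar r * tr a * r
  phi_bar : ∀ r : R, phi r = phi (σ.bar r * σ.lam)
  tr_phi : ∀ r : R, tr (phi r) = r + σ.bar r * σ.lam
  tr_symm : ∀ a : A, tr a = σ.bar (tr a) * σ.lam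
  act_add : ∀ (a : A) (r r' : R),
    act a (r + r') = act a r + phi (σ.bar r' * tr a * r) + act a r'

/-- A quadratic ring `(K, AK)`. -/
class QuadraticRing (K : Type*) (AK : Type*) [CommRing K] [StarRing K] [CommRing AK] where
  qs : QuadraticStructure (PseudoInvolution.ofStar K) AK
  mul_act : ∀ (a a' : AK) (k : K), a * qs.act a' k = qs.act (a * a') k
  mul_phi : ∀ (a : AK) (k : K), a * qs.phi k = qs.phi (qs.tr a * k)
  tr_one : qs.tr 1 = 1
  tr_mul : ∀ a a' : AK, qs.tr (a * a') = qs.tr a * qs.tr a'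

/-- The structure of a quadratic algebra over the quadratic ring `(K, AK)` on a `K`-algebra `R` and
an `AK`-module `A`: a pseudo-involution on `R` and a compatible quadratic structure. -/
structure QuadraticAlgebraStructure (K : Type*) (AK : Type*) [CommRing K] [StarRing K]
    [CommRing AK] [QuadraticRing K AK] (R : Type*) [Ring R] [Algebra K R]
    (A : Type*) [AddCommGroup A] [Module AK A] where
  inv : PseudoInvolution K R
  qs : QuadraticStructure inv A
  smul_act : ∀ (c : AK) (a : A) (r : R), c • qs.act a r = qs.act (c • a) r
  act_smul : ∀ (c : AK) (k : K) (a : A),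
    (QuadraticRing.qs (K := K) (AK := AK)).act c k • a = qs.act (c • a) (algebraMap K R k)
  smul_phi : ∀ (c : AK) (r : R),
    c • qs.phi r = qs.phi ((QuadraticRing.qs (K := K) (AK := AK)).tr c • r)
  phi_smul : ∀ (k : K) (a : A),
    (QuadraticRing.qs (K := K) (AK := AK)).phi k • a = qs.phi (k • qs.tr a)
  tr_smul : ∀ (c : AK) (a : A),
    qs.tr (c • a) = (QuadraticRing.qs (K := K) (AK := AK)).tr c • qs.tr a

/-- Quadratic algebras `(R, A)` over `(K, AK)`. -/
structure QuadAlg (K : Type v) (AK : Type w) [CommRing K] [StarRing K] [CommRing AK]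
    [QuadraticRing K AK] : Type (max (u + 1) v w) where
  carrier : Type u
  [ring : Ring carrier]
  [algebra : Algebra K carrier]
  A : Type u
  [addCommGroup : AddCommGroup A]
  [module : Module AK A]
  str : QuadraticAlgebraStructure K AK carrier A

namespace QuadAlg

variable {K : Type v} {AK : Type w} [CommRing K] [StarRing K] [CommRing AK] [QuadraticRing K AK]

instance : CoeSort (QuadAlg.{u} K AK) (Type u) := ⟨QuadAlg.carrier⟩

attribute [instance] QuadAlg.ring QuadAlg.algebra QuadAlg.addCommGroup QuadAlg.module

variable (R : QuadAlg.{u} K AK)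

abbrev bar : R →+ R := R.str.inv.bar
abbrev lam : Rˣ := R.str.inv.lam
abbrev act : R.A → R → R.A := R.str.qs.act
abbrev phi : R →+ R.A := R.str.qs.phi
abbrev tr : R.A →+ R := R.str.qs.tr

end QuadAlg

/-! ### Hermitian and quadratic forms -/

/-- A sesquilinear form on a right module over a ring with pseudo-involution. -/
def IsSesquilinear {K R P : Type*} [CommRing K] [StarRing K] [Ring R] [Algebra K R]
    (σ : PseudoInvolution K R) [AddCommGroup P] [Module Rᵐᵒᵖ P] (B : P →+ P →+ R) : Prop :=
  ∀ (p p' : P) (r r' : R), B (op r • p) (op r' • p') = σ.bar r * B p p' * r'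

/-- The map `p ↦ B(p, -)` from `P` to `Hom_R(P, R)`. -/
def IsSesquilinear.hat {K R P : Type*} [CommRing K] [StarRing K] [Ring R] [Algebra K R]
    {σ : PseudoInvolution K R} [AddCommGroup P] [Module Rᵐᵒᵖ P] {B : P →+ P →+ R}
    (h : IsSesquilinear σ B) (p : P) : P →ₗ[Rᵐᵒᵖ] R where
  toFun p' := B p p'
  map_add' := map_add (B p)
  map_smul' r p' := by simpa [σ.bar_one] using h p p' 1 r.unop

/-- A form is nondegenerate if the module is finitely generated projective, the form is sesquilinear,
and `p ↦ B(p, -)` is a bijection from `P` onto `Hom_R(P, R)`. -/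
structure IsNondegenerate {K R P : Type*} [CommRing K] [StarRing K] [Ring R] [Algebra K R]
    (σ : PseudoInvolution K R) [AddCommGroup P] [Module Rᵐᵒᵖ P] (B : P →+ P →+ R) : Prop where
  finite : Module.Finite Rᵐᵒᵖ P
  projective : Module.Projective Rᵐᵒᵖ P
  sesquilinear : IsSesquilinear σ B
  bijective : Function.Bijective sesquilinear.hat

/-- A hermitian form on an `S`-`R`-bimodule. -/
structure IsHermitian {K S R M : Type*} [CommRing K] [StarRing K] [Ring S] [Algebra K S]
    [Ring R] [Algebra K R] (σ : PseudoInvolution K S) (τ : PseudoInvolution K R)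
    [AddCommGroup M] [Module S M] [Module Rᵐᵒᵖ M] (B : M →+ M →+ R) : Prop where
  sesquilinear : IsSesquilinear τ B
  smul_left : ∀ (s : S) (m m' : M), B (s • m) m' = B m (σ.bar s • m')
  symm : ∀ m m' : M, B m ((σ.lam : S) • m') = τ.bar (B m' m) * τ.lam

/-- A quadratic form on an `S`-`R`-bimodule with a form `B`, where `(S, AS)` and `(R, AR)` are
quadratic algebras. -/
structure IsQuadraticForm {K AK S AS R AR M : Type*} [CommRing K] [StarRing K] [CommRing AK]
    [QuadraticRing K AK] [Ring S] [Algebra K S] [AddCommGroup AS] [Module AK AS]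
    [Ring R] [Algebra K R] [AddCommGroup AR] [Module AK AR]
    (σ : QuadraticAlgebraStructure K AK S AS) (τ : QuadraticAlgebraStructure K AK R AR)
    [AddCommGroup M] [Module S M] [Module Rᵐᵒᵖ M] (B : M →+ M →+ R) (q : AS → M → AR) : Prop where
  add_left : ∀ (a a' : AS) (m : M), q (a + a') m = q a m + q a' m
  act_left : ∀ (a : AS) (s : S) (m : M), q (σ.qs.act a s) m = q a (s • m)
  phi_left : ∀ (s : S) (m : M), q (σ.qs.phi s) m = τ.qs.phi (B m (s • m))
  smul_right : ∀ (a : AS) (m : M) (r : R), q a (op r • m) = τ.qs.act (q a m) r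
  add_right : ∀ (a : AS) (m m' : M),
    q a (m + m') = q a m + τ.qs.phi (B m (σ.qs.tr a • m')) + q a m'
  tr_apply : ∀ (a : AS) (m : M), τ.qs.tr (q a m) = B m (σ.qs.tr a • m)
  smul_left : ∀ (c : AK) (a : AS) (m : M), q (c • a) m = c • q a m

/-- Hermitian bimodules: `S`-`R`-bimodules on which the two actions of `K` coincide, with a hermitian
form. -/
structure HermBimod {K : Type v} {AK : Type w} [CommRing K] [StarRing K] [CommRing AK]
    [QuadraticRing K AK] (S R : QuadAlg.{u} K AK) : Type (u + 1) where
  carrier : Type u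
  [addCommGroup : AddCommGroup carrier]
  [left : Module S carrier]
  [right : Module (R : Type u)ᵐᵒᵖ carrier]
  [smulComm : SMulCommClass S (R : Type u)ᵐᵒᵖ carrier]
  central : ∀ (k : K) (m : carrier), algebraMap K S k • m = op (algebraMap K R k) • m
  form : carrier →+ carrier →+ R
  herm : IsHermitian S.str.inv R.str.inv form

attribute [instance] HermBimod.addCommGroup HermBimod.left HermBimod.right HermBimod.smulComm

instance {K : Type v} {AK : Type w} [CommRing K] [StarRing K] [CommRing AK] [QuadraticRing K AK]
    (S R : QuadAlg.{u} K AK) : CoeSort (HermBimod S R) (Type u) := ⟨HermBimod.carrier⟩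

/-- Quadratic bimodules: hermitian bimodules with a quadratic form. -/
structure QuadBimod {K : Type v} {AK : Type w} [CommRing K] [StarRing K] [CommRing AK]
    [QuadraticRing K AK] (S R : QuadAlg.{u} K AK) : Type (u + 1) extends HermBimod S R where
  q : S.A → carrier → R.A
  quad : IsQuadraticForm S.str R.str form q

instance {K : Type v} {AK : Type w} [CommRing K] [StarRing K] [CommRing AK] [QuadraticRing K AK]
    (S R : QuadAlg.{u} K AK) : CoeSort (QuadBimod S R) (Type u) := ⟨fun M => M.carrier⟩

/-- Isometries: bimodule homomorphisms that preserve the hermitian and the quadratic form. -/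
@[ext]
structure QuadBimod.Isometry {K : Type v} {AK : Type w} [CommRing K] [StarRing K] [CommRing AK]
    [QuadraticRing K AK] {S R : QuadAlg.{u} K AK} (M N : QuadBimod S R) where
  hom : M →+ N
  map_smul_left : ∀ (s : S) (m : M), hom (s • m) = s • hom m
  map_smul_right : ∀ (r : R) (m : M), hom (op r • m) = op r • hom m
  form_map : ∀ m m' : M, N.form (hom m) (hom m') = M.form m m'
  q_map : ∀ (a : S.A) (m : M), N.q a (hom m) = M.q a m

/-! ### Tensor products over noncommutative rings -/

section BalTensor

variable (S : Type*) (M : Type*) (N : Type*) [Ring S] [AddCommGroup M] [AddCommGroup N]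
  [Module Sᵐᵒᵖ M] [Module S N]

/-- The relations `(m s) ⊗ n = m ⊗ (s n)`. -/
def balancedRelations : AddSubgroup (M ⊗[ℤ] N) :=
  AddSubgroup.closure {x | ∃ (m : M) (s : S) (n : N), x = (op s • m) ⊗ₜ[ℤ] n - m ⊗ₜ[ℤ] (s • n)}

/-- The tensor product of a right `S`-module and a left `S`-module. -/
def BalTensor : Type _ := (M ⊗[ℤ] N) ⧸ balancedRelations S M N

namespace BalTensor

instance : AddCommGroup (BalTensor S M N) :=
  inferInstanceAs (AddCommGroup ((M ⊗[ℤ] N) ⧸ balancedRelations S M N))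

variable {M N}

/-- The pure tensor `m ⊗ n`. -/
def tmul (m : M) (n : N) : BalTensor S M N :=
  QuotientAddGroup.mk' (balancedRelations S M N) (m ⊗ₜ[ℤ] n)

theorem add_tmul (m m' : M) (n : N) : tmul S (m + m') n = tmul S m n + tmul S m' n := by
  simp only [tmul, TensorProduct.add_tmul, map_add]; rfl

theorem tmul_add (m : M) (n n' : N) : tmul S m (n + n') = tmul S m n + tmul S m n' := by
  simp only [tmul, TensorProduct.tmul_add, map_add]; rfl

theorem smul_tmul (m : M) (s : S) (n : N) : tmul S (op s • m) n = tmul S m (s • n) := by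
  refine (QuotientAddGroup.eq_iff_sub_mem (N := balancedRelations S M N)).2 ?_
  exact AddSubgroup.subset_closure ⟨m, s, n, rfl⟩

variable {S}

theorem zero_tmul (n : N) : tmul S (0 : M) n = 0 := by
  simp only [tmul, TensorProduct.zero_tmul, map_zero]; rfl

theorem induction {p : BalTensor S M N → Prop} (x : BalTensor S M N)
    (tmul : ∀ m n, p (tmul S m n)) (add : ∀ x y, p x → p y → p (x + y)) : p x := by
  obtain ⟨x, rfl⟩ := QuotientAddGroup.mk'_surjective _ x
  induction x with
  | zero =>
    have h := tmul 0 0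
    rw [zero_tmul] at h
    exact h
  | tmul m n => exact tmul m n
  | add x y hx hy => exact add _ _ hx hy

theorem hom_ext {G : Type*} [AddZeroClass G] {f g : BalTensor S M N →+ G}
    (h : ∀ m n, f (tmul S m n) = g (tmul S m n)) : f = g := by
  ext x
  induction x using BalTensor.induction with
  | tmul m n => exact h m n
  | add x y hx hy => rw [map_add, map_add, hx, hy]

/-- The additive map on the tensor product induced by a balanced biadditive map. -/
def lift {G : Type*} [AddCommGroup G] (f : M → N → G)
    (add_left : ∀ m m' n, f (m + m') n = f m n + f m' n)
    (add_right : ∀ m n n', f m (n + n') = f m n + f m n')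
    (balanced : ∀ m (s : S) n, f (op s • m) n = f m (s • n)) : BalTensor S M N →+ G :=
  QuotientAddGroup.lift (balancedRelations S M N)
    (TensorProduct.liftAddHom
      (AddMonoidHom.mk' (fun m => AddMonoidHom.mk' (f m) (add_right m))
        (fun m m' => by ext n; exact add_left m m' n))
      (fun r m n => by rw [map_zsmul, map_zsmul]; rfl))
    (by
      rw [balancedRelations, AddSubgroup.closure_le]
      rintro _ ⟨m, s, n, rfl⟩
      simpa [sub_eq_zero] using balanced m s n)

@[simp]
theorem lift_tmul {G : Type*} [AddCommGroup G] (f : M → N → G)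
    (h₁ : ∀ m m' n, f (m + m') n = f m n + f m' n)
    (h₂ : ∀ m n n', f m (n + n') = f m n + f m n')
    (h₃ : ∀ m (s : S) n, f (op s • m) n = f m (s • n)) (m : M) (n : N) :
    lift f h₁ h₂ h₃ (tmul S m n) = f m n := rfl

/-- The left action `t (m ⊗ n) = (t m) ⊗ n` on the tensor product. -/
@[reducible]
def leftModule (T : Type*) [Ring T] [Module T M] [SMulCommClass T Sᵐᵒᵖ M] :
    Module T (BalTensor S M N) :=
  letI : SMul T (BalTensor S M N) := ⟨fun t => lift (fun m n => tmul S (t • m) n)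
    (fun m m' n => by rw [smul_add, add_tmul]) (fun m n n' => tmul_add S _ n n')
    (fun m s n => by rw [smul_comm, smul_tmul])⟩
  have smul_def : ∀ (t : T) (m : M) (n : N), t • tmul S m n = tmul S (t • m) n := fun _ _ _ => rfl
  have smul_add' : ∀ (t : T) (x y : BalTensor S M N), t • (x + y) = t • x + t • y :=
    fun _ => map_add _
  Module.ofMinimalAxioms smul_add'
    (fun t t' x => by
      induction x using BalTensor.induction with
      | tmul m n => simp only [smul_def, add_smul, add_tmul]
      | add x y hx hy => simp only [smul_add', hx, hy]; abel)
    (fun t t' x => by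
      induction x using BalTensor.induction with
      | tmul m n => simp only [smul_def, mul_smul]
      | add x y hx hy => simp only [smul_add', hx, hy])
    (fun x => by
      induction x using BalTensor.induction with
      | tmul m n => simp only [smul_def, one_smul]
      | add x y hx hy => simp only [smul_add', hx, hy])

/-- The right action `(m ⊗ n) r = m ⊗ (n r)` on the tensor product. -/
@[reducible]
def rightModule (R : Type*) [Ring R] [Module Rᵐᵒᵖ N] [SMulCommClass S Rᵐᵒᵖ N] :
    Module Rᵐᵒᵖ (BalTensor S M N) :=
  letI : SMul Rᵐᵒᵖ (BalTensor S M N) := ⟨fun r => lift (fun m n => tmul S m (r • n))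
    (fun m m' n => add_tmul S m m' _) (fun m n n' => by rw [smul_add, tmul_add])
    (fun m s n => by rw [← smul_comm, smul_tmul])⟩
  have smul_def : ∀ (r : Rᵐᵒᵖ) (m : M) (n : N), r • tmul S m n = tmul S m (r • n) :=
    fun _ _ _ => rfl
  have smul_add' : ∀ (r : Rᵐᵒᵖ) (x y : BalTensor S M N), r • (x + y) = r • x + r • y :=
    fun _ => map_add _
  Module.ofMinimalAxioms smul_add'
    (fun t t' x => by
      induction x using BalTensor.induction with
      | tmul m n => simp only [smul_def, add_smul, tmul_add]
      | add x y hx hy => simp only [smul_add', hx, hy]; abel)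
    (fun t t' x => by
      induction x using BalTensor.induction with
      | tmul m n => simp only [smul_def, mul_smul]
      | add x y hx hy => simp only [smul_add', hx, hy])
    (fun x => by
      induction x using BalTensor.induction with
      | tmul m n => simp only [smul_def, one_smul]
      | add x y hx hy => simp only [smul_add', hx, hy])

end BalTensor

end BalTensor

/-! ### Extending quadratic maps from pure tensors -/

/-- The abelian group `A × X` with addition `(a, x) + (b, y) = (a + b + β x y, x + y)`. -/
@[ext]
structure TwistedSum {A X : Type*} [AddCommGroup A] [AddCommGroup X] (β : X →+ X →+ A)
    (symm : ∀ x y, β x y = β y x) where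
  fst : A
  snd : X

namespace TwistedSum

variable {A X : Type*} [AddCommGroup A] [AddCommGroup X] {β : X →+ X →+ A}
  {symm : ∀ x y, β x y = β y x}

instance : Add (TwistedSum β symm) := ⟨fun x y => ⟨x.1 + y.1 + β x.2 y.2, x.2 + y.2⟩⟩
instance : Zero (TwistedSum β symm) := ⟨⟨0, 0⟩⟩
instance : Neg (TwistedSum β symm) := ⟨fun x => ⟨-x.1 + β x.2 x.2, -x.2⟩⟩

theorem fst_add (x y : TwistedSum β symm) : (x + y).fst = x.fst + y.fst + β x.snd y.snd := rfl
theorem snd_add (x y : TwistedSum β symm) : (x + y).snd = x.snd + y.snd := rfl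

instance : AddCommGroup (TwistedSum β symm) :=
  { AddGroup.ofLeftAxioms (G := TwistedSum β symm)
      (fun x y z => by
        ext
        · simp only [fst_add, snd_add, map_add, AddMonoidHom.add_apply]; abel
        · simp only [snd_add, add_assoc])
      (fun x => by
        ext
        · change 0 + x.1 + β 0 x.2 = x.1
          simp
        · exact zero_add x.2)
      (fun x => by
        ext
        · change -x.1 + β x.2 x.2 + x.1 + β (-x.2) x.2 = 0
          rw [map_neg, AddMonoidHom.neg_apply]; abel
        · exact neg_add_cancel x.2) with
    add_comm := fun x y => by
      ext
      · simp only [fst_add, symm x.2 y.2, add_comm x.1 y.1]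
      · exact add_comm x.2 y.2 }

/-- The projection onto `X`. -/
def sndHom : TwistedSum β symm →+ X := AddMonoidHom.mk' snd snd_add

end TwistedSum

namespace BalTensor

variable {S M N A : Type*} [Ring S] [AddCommGroup M] [AddCommGroup N] [Module Sᵐᵒᵖ M] [Module S N]
  [AddCommGroup A] (β : BalTensor S M N →+ BalTensor S M N →+ A) (symm : ∀ x y, β x y = β y x)
  (f : M → N → A)
  (h₁ : ∀ m m' n, f (m + m') n = f m n + f m' n + β (tmul S m n) (tmul S m' n))
  (h₂ : ∀ m n n', f m (n + n') = f m n + f m n' + β (tmul S m n) (tmul S m n'))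
  (h₃ : ∀ m (s : S) n, f (op s • m) n = f m (s • n))

/-- Auxiliary map for `quadLift`. -/
def quadLiftAux : BalTensor S M N →+ TwistedSum β symm :=
  lift (fun m n => ⟨f m n, tmul S m n⟩)
    (fun m m' n => TwistedSum.ext (h₁ m m' n) (add_tmul S m m' n))
    (fun m n n' => TwistedSum.ext (h₂ m n n') (tmul_add S m n n'))
    (fun m s n => TwistedSum.ext (h₃ m s n) (smul_tmul S m s n))

/-- The unique map on the tensor product with the given values on pure tensors and with polarization
`β`; its value at a sum `∑ mᵢ ⊗ nᵢ` is `∑ f mᵢ nᵢ + ∑_{i < j} β (mᵢ ⊗ nᵢ) (mⱼ ⊗ nⱼ)`. -/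
def quadLift (x : BalTensor S M N) : A := (quadLiftAux β symm f h₁ h₂ h₃ x).fst

theorem quadLift_tmul (m : M) (n : N) : quadLift β symm f h₁ h₂ h₃ (tmul S m n) = f m n := rfl

theorem quadLift_add (x y : BalTensor S M N) : quadLift β symm f h₁ h₂ h₃ (x + y) =
    quadLift β symm f h₁ h₂ h₃ x + quadLift β symm f h₁ h₂ h₃ y + β x y := by
  have h : ∀ x, (quadLiftAux β symm f h₁ h₂ h₃ x).snd = x := fun x =>
    DFunLike.congr_fun (f := TwistedSum.sndHom.comp (quadLiftAux β symm f h₁ h₂ h₃))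
      (g := AddMonoidHom.id _) (hom_ext fun _ _ => rfl) x
  rw [quadLift, map_add, TwistedSum.fst_add, h, h]; rfl

end BalTensor

/-! ### Tensor products of hermitian and quadratic bimodules -/

section Tensor

variable {K : Type v} {AK : Type w} [CommRing K] [StarRing K] [CommRing AK] [QuadraticRing K AK]
  {T S R : QuadAlg.{u} K AK}

namespace HermBimod

section Lemmas

variable (M : HermBimod S R)

theorem form_smul_right (m m' : M) (r : R) : M.form m (op r • m') = M.form m m' * r := by
  simpa [S.str.inv.bar_one, R.str.inv.bar_one] using M.herm.sesquilinear m m' 1 r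

theorem form_op_smul (m m' : M) (r : R) : M.form (op r • m) m' = R.bar r * M.form m m' := by
  simpa using M.herm.sesquilinear m m' r 1

theorem form_smul_left (s : S) (m m' : M) : M.form (s • m) m' = M.form m (S.bar s • m') :=
  M.herm.smul_left s m m'

theorem form_symm (m m' : M) : M.form m ((S.lam : S) • m') = R.bar (M.form m' m) * R.lam :=
  M.herm.symm m m'

/-- The biadditive map `(x, y) ↦ phi (B (x, tr a y))`. -/
def polar (a : S.A) : M →+ M →+ R.A :=
  AddMonoidHom.mk' (fun x => AddMonoidHom.mk' (fun y => R.phi (M.form x (S.tr a • y)))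
    (fun y z => by rw [smul_add, map_add, map_add]))
    (fun x y => by ext z; simp)

theorem polar_apply (a : S.A) (x y : M) : M.polar a x y = R.phi (M.form x (S.tr a • y)) := rfl

theorem form_tr_symm (a : S.A) (x y : M) :
    R.bar (M.form x (S.tr a • y)) * R.lam = M.form y (S.tr a • x) := by
  rw [← form_symm, form_smul_left, smul_smul]
  exact congrArg (fun t => M.form y (t • x)) (S.str.qs.tr_symm a).symm

theorem form_algebra_smul (k : K) (s : S) (x y : M) :
    M.form x ((k • s) • y) = k • M.form x (s • y) := by
  rw [Algebra.smul_def, mul_smul, M.central, form_smul_right, Algebra.smul_def, Algebra.commutes]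

theorem polar_symm (a : S.A) (x y : M) : M.polar a x y = M.polar a y x := by
  rw [polar_apply, polar_apply, R.str.qs.phi_bar]
  change R.phi (R.bar (M.form x (S.tr a • y)) * R.lam) = _
  rw [form_tr_symm]

end Lemmas

variable (L : HermBimod T S) (M : HermBimod S R)

/-- The hermitian form `B (l ⊗ m, l' ⊗ m') = B (m, B (l, l') m')` on the tensor product. -/
def tensorForm : BalTensor S L M →+ BalTensor S L M →+ R :=
  BalTensor.lift
    (fun l m => BalTensor.lift (fun l' m' => M.form m (L.form l l' • m'))
      (fun x y z => by rw [map_add, add_smul, map_add])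
      (fun x y z => by rw [smul_add, map_add])
      (fun x s y => by rw [form_smul_right, mul_smul]))
    (fun x y z => BalTensor.hom_ext fun l m => by
      simp only [BalTensor.lift_tmul, map_add, AddMonoidHom.add_apply, add_smul])
    (fun x y z => BalTensor.hom_ext fun l m => by
      simp only [BalTensor.lift_tmul, map_add, AddMonoidHom.add_apply])
    (fun x s y => BalTensor.hom_ext fun l m => by
      simp only [BalTensor.lift_tmul]
      rw [form_op_smul, form_smul_left, mul_smul])

theorem tensorForm_tmul (l l' : L) (m m' : M) :
    tensorForm L M (BalTensor.tmul S l m) (BalTensor.tmul S l' m') =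
      M.form m (L.form l l' • m') := rfl

/-- The tensor product of hermitian bimodules. -/
def tensor : HermBimod T R :=
  letI : Module T (BalTensor S L M) := BalTensor.leftModule T
  letI : Module (R : Type u)ᵐᵒᵖ (BalTensor S L M) := BalTensor.rightModule R
  have hl : ∀ (t : T) (l : L) (m : M), t • BalTensor.tmul S l m = BalTensor.tmul S (t • l) m :=
    fun _ _ _ => rfl
  have hr : ∀ (r : (R : Type u)ᵐᵒᵖ) (l : L) (m : M),
    r • BalTensor.tmul S l m = BalTensor.tmul S l (r • m) := fun _ _ _ => rfl
  { carrier := BalTensor S L M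
    smulComm := ⟨fun t r x => by
      induction x using BalTensor.induction with
      | tmul l m => rfl
      | add x y hx hy => simp only [smul_add, hx, hy]⟩
    central := fun k x => by
      induction x using BalTensor.induction with
      | tmul l m => rw [hl, hr, L.central, BalTensor.smul_tmul, M.central]
      | add x y hx hy => simp only [smul_add, hx, hy]
    form := tensorForm L M
    herm :=
      { sesquilinear := fun x y r r' => by
          induction x using BalTensor.induction with
          | add x x' hx hx' =>
            simp only [smul_add, map_add, AddMonoidHom.add_apply, hx, hx', mul_add, add_mul]
          | tmul l m =>
            induction y using BalTensor.induction with
            | add y y' hy hy' => simp only [smul_add, map_add, hy, hy', mul_add, add_mul]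
            | tmul l' m' =>
              rw [hr, hr, tensorForm_tmul, tensorForm_tmul, smul_comm]
              exact M.herm.sesquilinear _ _ _ _
        smul_left := fun t x y => by
          induction x using BalTensor.induction with
          | add x x' hx hx' => simp only [smul_add, map_add, AddMonoidHom.add_apply, hx, hx']
          | tmul l m =>
            induction y using BalTensor.induction with
            | add y y' hy hy' => simp only [smul_add, map_add, hy, hy']
            | tmul l' m' =>
              rw [hl, hl, tensorForm_tmul, tensorForm_tmul, L.herm.smul_left]
        symm := fun x y => by
          induction x using BalTensor.induction with
          | add x x' hx hx' =>
            simp only [map_add, AddMonoidHom.add_apply, hx, hx', add_mul]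
          | tmul l m =>
            induction y using BalTensor.induction with
            | add y y' hy hy' =>
              simp only [smul_add, map_add, AddMonoidHom.add_apply, hy, hy', add_mul]
            | tmul l' m' =>
              rw [hl, tensorForm_tmul, tensorForm_tmul, form_symm, mul_smul]
              change _ = R.bar _ * _
              rw [← form_symm, form_smul_left] } }

/-- The pure tensor `l ⊗ m` in the tensor product of bimodules. -/
def tmul {L : HermBimod T S} {M : HermBimod S R} (l : L) (m : M) : L.tensor M :=
  BalTensor.tmul S l m

variable {L M}

theorem add_tmul (l l' : L) (m : M) : tmul (l + l') m = tmul l m + tmul l' m :=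
  BalTensor.add_tmul S l l' m

theorem tmul_add (l : L) (m m' : M) : tmul l (m + m') = tmul l m + tmul l m' :=
  BalTensor.tmul_add S l m m'

theorem smul_tmul (l : L) (s : S) (m : M) : tmul (op s • l) m = tmul l (s • m) :=
  BalTensor.smul_tmul S l s m

theorem left_smul_tmul (t : T) (l : L) (m : M) : t • tmul l m = tmul (t • l) m := rfl

theorem right_smul_tmul (r : R) (l : L) (m : M) : op r • tmul l m = tmul l (op r • m) := rfl

theorem form_tmul (l l' : L) (m m' : M) :
    (L.tensor M).form (tmul l m) (tmul l' m') = M.form m (L.form l l' • m') := rfl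

theorem tmul_induction {p : L.tensor M → Prop} (x : L.tensor M)
    (tmul : ∀ l m, p (tmul l m)) (add : ∀ x y, p x → p y → p (x + y)) : p x :=
  BalTensor.induction x tmul add

end HermBimod

namespace QuadBimod

open HermBimod (tmul add_tmul tmul_add smul_tmul left_smul_tmul right_smul_tmul form_tmul
  tmul_induction)

variable (L : QuadBimod T S) (M : QuadBimod S R)

theorem q_add_right (a : S.A) (m m' : M) : M.q a (m + m') = M.q a m + M.q a m' + M.polar a m m' := by
  rw [M.quad.add_right]
  exact add_right_comm _ _ _

/-- The quadratic form on the tensor product: the quadratic map with polarization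
`(x, y) ↦ phi (B (x, tr a y))` and with value `q (q (a, l), m)` at the pure tensor `l ⊗ m`. -/
def tensorQ (a : T.A) : L.tensor M.toHermBimod → R.A :=
  BalTensor.quadLift ((L.tensor M.toHermBimod).polar a) ((L.tensor M.toHermBimod).polar_symm a)
    (fun l m => M.q (L.q a l) m)
    (fun l l' m => by
      rw [q_add_right, M.quad.add_left, M.quad.add_left]
      exact congrArg _ (M.quad.phi_left _ _))
    (fun l m m' => by
      rw [q_add_right]
      exact congrArg _ (congrArg (fun t => R.phi (M.form m (t • m'))) (L.quad.tr_apply _ _)))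
    (fun l s m => by rw [L.quad.smul_right, M.quad.act_left])

theorem tensorQ_tmul (a : T.A) (l : L) (m : M) : tensorQ L M a (tmul l m) = M.q (L.q a l) m := rfl

theorem tensorQ_add (a : T.A) (x y : L.tensor M.toHermBimod) :
    tensorQ L M a (x + y) =
      tensorQ L M a x + tensorQ L M a y + (L.tensor M.toHermBimod).polar a x y :=
  BalTensor.quadLift_add _ _ _ _ _ _ _ _

/-- The tensor product of quadratic bimodules. -/
def tensor : QuadBimod T R where
  toHermBimod := L.toHermBimod.tensor M.toHermBimod
  q := tensorQ L M
  quad :=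
    { add_left := fun a b x => by
        induction x using tmul_induction with
        | tmul l m => simp only [tensorQ_tmul, L.quad.add_left, M.quad.add_left]
        | add x y hx hy =>
          simp only [tensorQ_add, hx, hy, HermBimod.polar_apply, map_add, add_smul]; abel
      act_left := fun a t x => by
        induction x using tmul_induction with
        | tmul l m => simp only [left_smul_tmul, tensorQ_tmul, L.quad.act_left]
        | add x y hx hy =>
          simp only [smul_add, tensorQ_add, hx, hy, HermBimod.polar_apply, T.str.qs.tr_act,
            HermBimod.form_smul_left, smul_smul, mul_assoc]
      phi_left := fun t x => by
        induction x using tmul_induction with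
        | tmul l m =>
          rw [tensorQ_tmul, L.quad.phi_left, M.quad.phi_left]; rfl
        | add x y hx hy =>
          have h : R.phi ((L.toHermBimod.tensor M.toHermBimod).form x
              ((T.bar t * T.lam) • y)) =
              R.phi ((L.toHermBimod.tensor M.toHermBimod).form y (t • x)) := by
            rw [mul_smul, ← HermBimod.form_smul_left, HermBimod.form_symm]
            exact (R.str.qs.phi_bar _).symm
          rw [tensorQ_add, hx, hy, HermBimod.polar_apply]
          change _ + R.phi (HermBimod.form _ x (T.str.qs.tr (T.str.qs.phi t) • y)) = _
          rw [T.str.qs.tr_phi, add_smul, map_add, map_add, h, smul_add]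
          simp only [map_add, AddMonoidHom.add_apply]
          abel
      smul_right := fun a x r => by
        induction x using tmul_induction with
        | tmul l m => simp only [right_smul_tmul, tensorQ_tmul, M.quad.smul_right]
        | add x y hx hy =>
          rw [smul_add, tensorQ_add, hx, hy, tensorQ_add, R.str.qs.add_act, R.str.qs.add_act,
            HermBimod.polar_apply, HermBimod.polar_apply, ← R.str.qs.phi_act, smul_comm,
            HermBimod.form_smul_right, HermBimod.form_op_smul]
      add_right := fun a x y => by
        rw [tensorQ_add]
        exact add_right_comm _ _ _
      tr_apply := fun a x => by
        induction x using tmul_induction with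
        | tmul l m =>
          rw [tensorQ_tmul, M.quad.tr_apply, L.quad.tr_apply]; rfl
        | add x y hx hy =>
          rw [tensorQ_add, map_add, map_add, hx, hy, HermBimod.polar_apply, R.str.qs.tr_phi,
            HermBimod.form_tr_symm, smul_add]
          simp only [map_add, AddMonoidHom.add_apply]
          abel
      smul_left := fun c a x => by
        induction x using tmul_induction with
        | tmul l m => simp only [tensorQ_tmul, L.quad.smul_left, M.quad.smul_left]
        | add x y hx hy =>
          rw [tensorQ_add, tensorQ_add, hx, hy, smul_add, smul_add, HermBimod.polar_apply,
            HermBimod.polar_apply, T.str.tr_smul, HermBimod.form_algebra_smul]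
          congr 1
          exact (R.str.smul_phi _ _).symm }

end QuadBimod

end Tensor

/-! ### The bicategory of quadratic bimodules -/

section Bicategory

variable {K : Type v} {AK : Type w} [CommRing K] [StarRing K] [CommRing AK] [QuadraticRing K AK]
  {U T S R : QuadAlg.{u} K AK}

namespace QuadBimod

section Tmul

variable {L : QuadBimod T S} {M : QuadBimod S R}

/-- The pure tensor `l ⊗ m` in the tensor product of quadratic bimodules. -/
def tmul (l : L) (m : M) : L.tensor M := BalTensor.tmul S l m

theorem add_tmul (l l' : L) (m : M) : tmul (l + l') m = tmul l m + tmul l' m :=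
  BalTensor.add_tmul S l l' m

theorem tmul_add (l : L) (m m' : M) : tmul l (m + m') = tmul l m + tmul l m' :=
  BalTensor.tmul_add S l m m'

theorem smul_tmul (l : L) (s : S) (m : M) : tmul (op s • l) m = tmul l (s • m) :=
  BalTensor.smul_tmul S l s m

theorem left_smul_tmul (t : T) (l : L) (m : M) : t • tmul l m = tmul (t • l) m := rfl

theorem right_smul_tmul (r : R) (l : L) (m : M) : op r • tmul l m = tmul l (op r • m) := rfl

theorem form_tmul (l l' : L) (m m' : M) :
    (L.tensor M).form (tmul l m) (tmul l' m') = M.form m (L.form l l' • m') := rfl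

theorem q_tmul (a : T.A) (l : L) (m : M) : (L.tensor M).q a (tmul l m) = M.q (L.q a l) m := rfl

theorem tmul_induction {p : L.tensor M → Prop} (x : L.tensor M)
    (tmul : ∀ l m, p (tmul l m)) (add : ∀ x y, p x → p y → p (x + y)) : p x :=
  BalTensor.induction x tmul add

theorem hom_ext {G : Type*} [AddZeroClass G] {f g : L.tensor M →+ G}
    (h : ∀ l m, f (tmul l m) = g (tmul l m)) : f = g :=
  BalTensor.hom_ext h

/-- The additive map on the tensor product of bimodules induced by a balanced biadditive map. -/
def lift {G : Type*} [AddCommGroup G] (f : L → M → G)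
    (add_left : ∀ l l' m, f (l + l') m = f l m + f l' m)
    (add_right : ∀ l m m', f l (m + m') = f l m + f l m')
    (balanced : ∀ l (s : S) m, f (op s • l) m = f l (s • m)) : L.tensor M →+ G :=
  BalTensor.lift f add_left add_right balanced

theorem lift_tmul {G : Type*} [AddCommGroup G] (f : L → M → G)
    (h₁ : ∀ l l' m, f (l + l') m = f l m + f l' m)
    (h₂ : ∀ l m m', f l (m + m') = f l m + f l m')
    (h₃ : ∀ l (s : S) m, f (op s • l) m = f l (s • m)) (l : L) (m : M) :
    lift f h₁ h₂ h₃ (tmul l m) = f l m := rfl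

end Tmul

/-- The identity quadratic bimodule of `R`: the bimodule `R` with the forms `bar r * r'` and
`(a, r) ↦ act a r`. -/
def one (R : QuadAlg.{u} K AK) : QuadBimod R R where
  carrier := R
  central k r := by
    rw [op_smul_eq_mul, smul_eq_mul, Algebra.commutes]
  form := AddMonoidHom.mk' (fun r => AddMonoidHom.mk' (fun r' => R.bar r * r') (mul_add _))
    (fun r s => by ext t; simp [add_mul])
  herm :=
    { sesquilinear := fun p p' r r' => by
        change R.bar (p * r) * (p' * r') = R.bar r * (R.bar p * p') * r'
        rw [R.str.inv.bar_mul]; simp only [mul_assoc]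
      smul_left := fun s m m' => by
        change R.bar (s * m) * m' = R.bar m * (R.bar s * m')
        rw [R.str.inv.bar_mul, mul_assoc]
      symm := fun m m' => by
        change R.bar m * (R.lam * m') = R.bar (R.bar m' * m) * R.lam
        have h : R.bar R.lam * (R.lam : R) = 1 := by
          have h' := R.str.inv.bar_bar 1
          rw [R.str.inv.bar_one, R.str.inv.bar_one, mul_one] at h'
          rw [Units.eq_inv_of_mul_eq_one_left h'.symm, R.lam.inv_mul]
        rw [R.str.inv.bar_mul, R.str.inv.bar_bar]
        simp only [mul_assoc]
        rw [h, mul_one] }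
  q := R.act
  quad :=
    { add_left := R.str.qs.add_act
      act_left := fun a s m => (R.str.qs.act_mul a s m).symm
      phi_left := fun s m => by
        change R.act (R.phi s) m = R.phi (R.bar m * (s * m))
        rw [← mul_assoc]
        exact (R.str.qs.phi_act s m).symm
      smul_right := fun a m r => R.str.qs.act_mul a m r
      add_right := fun a m m' => by
        have h := R.str.qs.act_add a m' m
        rw [add_comm (m' : R), mul_assoc] at h
        have e : ∀ x y z : R.A, x + y + z = z + y + x := fun x y z => by abel
        exact h.trans (e _ _ _)
      tr_apply := fun a m => by
        change R.tr (R.act a m) = R.bar m * (R.tr a * m)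
        rw [← mul_assoc]
        exact R.str.qs.tr_act a m
      smul_left := fun c a m => (R.str.smul_act c a m).symm }

/-- An element of `R` as an element of the identity bimodule. -/
def one.of (r : R) : one R := r

/-- An element of the identity bimodule as an element of `R`. -/
def one.val (r : one R) : R := r

theorem one_form (r r' : R) : (one R).form r r' = R.bar r * r' := rfl

theorem one_q (a : R.A) (r : R) : (one R).q a r = R.act a r := rfl

namespace Isometry

/-- A bimodule homomorphism out of a tensor product is an isometry if it preserves the forms on pure
tensors. -/
def ofTensor {L : QuadBimod T S} {M : QuadBimod S R} {N : QuadBimod T R} (f : L.tensor M →+ N)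
    (left : ∀ (t : T) (l : L) (m : M), f (tmul (t • l) m) = t • f (tmul l m))
    (right : ∀ (r : R) (l : L) (m : M), f (tmul l (op r • m)) = op r • f (tmul l m))
    (form : ∀ (l l' : L) (m m' : M),
      N.form (f (tmul l m)) (f (tmul l' m')) = M.form m (L.form l l' • m'))
    (q : ∀ (a : T.A) (l : L) (m : M), N.q a (f (tmul l m)) = M.q (L.q a l) m) :
    Isometry (L.tensor M) N :=
  have hl : ∀ (t : T) (x : L.tensor M), f (t • x) = t • f x := fun t x => by
    induction x using tmul_induction with
    | tmul l m => exact left t l m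
    | add x y hx hy => rw [smul_add, map_add, hx, hy, map_add, smul_add]
  have hB : ∀ x y : L.tensor M, N.form (f x) (f y) = (L.tensor M).form x y := fun x y => by
    induction x using tmul_induction with
    | tmul l m =>
      induction y using tmul_induction with
      | tmul l' m' => exact form l l' m m'
      | add x y hx hy => simp only [map_add, hx, hy]
    | add x y hx hy => simp only [map_add, AddMonoidHom.add_apply, hx, hy]
  { hom := f
    map_smul_left := hl
    map_smul_right := fun r x => by
      induction x using tmul_induction with
      | tmul l m => exact right r l m
      | add x y hx hy => rw [smul_add, map_add, hx, hy, map_add, smul_add]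
    form_map := hB
    q_map := fun a x => by
      induction x using tmul_induction with
      | tmul l m => exact q a l m
      | add x y hx hy =>
        rw [map_add, q_add_right, q_add_right, hx, hy, HermBimod.polar_apply,
          HermBimod.polar_apply, ← hl, hB] }

/-- The identity isometry. -/
def id (M : QuadBimod S R) : Isometry M M where
  hom := AddMonoidHom.id M
  map_smul_left _ _ := rfl
  map_smul_right _ _ := rfl
  form_map _ _ := rfl
  q_map _ _ := rfl

/-- The composition of isometries. -/
def comp {M N P : QuadBimod S R} (f : Isometry M N) (g : Isometry N P) : Isometry M P where
  hom := g.hom.comp f.hom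
  map_smul_left s m := by simp [f.map_smul_left, g.map_smul_left]
  map_smul_right s m := by simp [f.map_smul_right, g.map_smul_right]
  form_map _ _ := by simp [f.form_map, g.form_map]
  q_map _ _ := by simp [f.q_map, g.q_map]

end Isometry

/-- Quadratic bimodules and isometries form a category. -/
instance : Category (QuadBimod S R) where
  Hom := Isometry
  id := Isometry.id
  comp := Isometry.comp

@[ext]
theorem isometry_ext {M N : QuadBimod S R} {f g : M ⟶ N} (h : ∀ m, f.hom m = g.hom m) : f = g :=
  Isometry.ext (AddMonoidHom.ext h)

@[simp]
theorem id_hom_apply (M : QuadBimod S R) (m : M) : Isometry.hom (𝟙 M) m = m := rfl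

@[simp]
theorem comp_hom_apply {M N P : QuadBimod S R} (f : M ⟶ N) (g : N ⟶ P) (m : M) :
    (f ≫ g).hom m = g.hom (f.hom m) := rfl

/-- A bijective isometry is an isomorphism. -/
def mkIso {M N : QuadBimod S R} (f : Isometry M N) (g : N → M) (hgf : ∀ m, g (f.hom m) = m)
    (hfg : ∀ n, f.hom (g n) = n) : M ≅ N where
  hom := f
  inv :=
    { hom := AddMonoidHom.mk' g (fun n n' => by
        conv_lhs => rw [← hfg n, ← hfg n', ← map_add, hgf])
      map_smul_left := fun s n => by
        change g (s • n) = s • g n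
        conv_lhs => rw [← hfg n, ← f.map_smul_left, hgf]
      map_smul_right := fun r n => by
        change g (op r • n) = op r • g n
        conv_lhs => rw [← hfg n, ← f.map_smul_right, hgf]
      form_map := fun n n' => by
        change M.form (g n) (g n') = _
        rw [← f.form_map, hfg, hfg]
      q_map := fun a n => by
        change M.q a (g n) = _
        rw [← f.q_map, hfg] }
  hom_inv_id := isometry_ext hgf
  inv_hom_id := isometry_ext hfg

/-- The tensor product of two isometries. -/
def tensorMap {L L' : QuadBimod T S} {M M' : QuadBimod S R} (f : L ⟶ L') (g : M ⟶ M') :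
    L.tensor M ⟶ L'.tensor M' :=
  Isometry.ofTensor (N := L'.tensor M')
    (lift (fun l m => tmul (f.hom l) (g.hom m))
      (fun l l' m => by rw [map_add, add_tmul]) (fun l m m' => by rw [map_add, tmul_add])
      (fun l s m => by rw [f.map_smul_right, smul_tmul, g.map_smul_left]))
    (fun t l m => by rw [lift_tmul, lift_tmul, f.map_smul_left, left_smul_tmul])
    (fun r l m => by rw [lift_tmul, lift_tmul, g.map_smul_right, right_smul_tmul])
    (fun l l' m m' => by
      rw [lift_tmul, lift_tmul, form_tmul, f.form_map, ← g.map_smul_left, g.form_map])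
    (fun a l m => by rw [lift_tmul, q_tmul, f.q_map, g.q_map])

@[simp]
theorem tensorMap_tmul {L L' : QuadBimod T S} {M M' : QuadBimod S R} (f : L ⟶ L') (g : M ⟶ M')
    (l : L) (m : M) : (tensorMap f g).hom (tmul l m) = tmul (f.hom l) (g.hom m) := rfl

theorem tensor_hom_ext {L : QuadBimod T S} {M : QuadBimod S R} {N : QuadBimod T R}
    {f g : L.tensor M ⟶ N} (h : ∀ l m, f.hom (tmul l m) = g.hom (tmul l m)) : f = g :=
  Isometry.ext (hom_ext h)

/-- The isometry `S ⊗ M ≅ M`, `s ⊗ m ↦ s m`. -/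
def oneTensor (M : QuadBimod S R) : (one S).tensor M ≅ M :=
  mkIso
    (Isometry.ofTensor
      (lift (fun s m => one.val s • m) (fun s s' m => add_smul (one.val s) (one.val s') m)
        (fun s m m' => smul_add _ _ _) (fun s t m => mul_smul (one.val s) t m))
      (fun t s m => mul_smul t (one.val s) m)
      (fun r s m => smul_comm (one.val s) (op r) m)
      (fun s s' m m' => by
        refine (M.form_smul_left (one.val s) m (one.val s' • m')).trans ?_
        exact congrArg (M.form m) (smul_smul (S.bar (one.val s)) (one.val s') m'))
      (fun a s m => (M.quad.act_left a (one.val s) m).symm))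
    (fun m => tmul (one.of 1) m)
    (fun x => by
      induction x using tmul_induction with
      | tmul s m =>
        refine (smul_tmul (one.of 1) (one.val s) m).symm.trans ?_
        exact congrArg (fun t : one S => tmul t m) (one_mul (one.val s))
      | add x y hx hy =>
        conv_rhs => rw [← hx, ← hy, ← tmul_add, ← map_add])
    (fun m => one_smul S m)

theorem oneTensor_tmul (M : QuadBimod S R) (s : one S) (m : M) :
    (oneTensor M).hom.hom (tmul s m) = one.val s • m := rfl

theorem oneTensor_inv (M : QuadBimod S R) (m : M) :
    (oneTensor M).inv.hom m = tmul (one.of 1) m := rfl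

/-- The isometry `M ⊗ R ≅ M`, `m ⊗ r ↦ m r`. -/
def tensorOne (M : QuadBimod S R) : M.tensor (one R) ≅ M :=
  mkIso
    (Isometry.ofTensor
      (lift (fun m r => op (one.val r) • m) (fun m m' r => smul_add _ _ _)
        (fun m r r' => add_smul (op (one.val r)) (op (one.val r')) m)
        (fun m r r' => (mul_smul (op (one.val r')) (op r) m).symm))
      (fun s m r => (smul_comm s (op (one.val r)) m).symm)
      (fun r m r' => mul_smul (op r) (op (one.val r')) m)
      (fun m m' r r' => by
        refine (M.herm.sesquilinear m m' (one.val r) (one.val r')).trans ?_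
        exact mul_assoc (R.bar (one.val r)) (M.form m m') (one.val r'))
      (fun a m r => M.quad.smul_right a m (one.val r)))
    (fun m => tmul m (one.of 1))
    (fun x => by
      induction x using tmul_induction with
      | tmul m r =>
        refine (smul_tmul m (one.val r) (one.of 1)).trans ?_
        exact congrArg (fun t : one R => tmul m t) (mul_one (one.val r))
      | add x y hx hy =>
        conv_rhs => rw [← hx, ← hy, ← add_tmul, ← map_add])
    (fun m => one_smul (R : Type u)ᵐᵒᵖ m)

theorem tensorOne_tmul (M : QuadBimod S R) (m : M) (r : one R) :
    (tensorOne M).hom.hom (tmul m r) = op (one.val r) • m := rfl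

theorem tensorOne_inv (M : QuadBimod S R) (m : M) :
    (tensorOne M).inv.hom m = tmul m (one.of 1) := rfl

/-- The additive map `l ⊗ (m ⊗ n) ↦ (l ⊗ m) ⊗ n`. -/
def assocFun (L : QuadBimod U T) (M : QuadBimod T S) (N : QuadBimod S R) :
    L.tensor (M.tensor N) →+ (L.tensor M).tensor N :=
  lift (fun l => lift (fun m n => tmul (tmul l m) n)
      (fun m m' n => by rw [tmul_add, add_tmul]) (fun m n n' => by rw [tmul_add])
      (fun m s n => by rw [← right_smul_tmul, smul_tmul]))
    (fun l l' x => by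
      induction x using tmul_induction with
      | tmul m n => simp only [lift_tmul, add_tmul]
      | add x y hx hy => simp only [map_add, hx, hy]; abel)
    (fun l x y => map_add _ _ _)
    (fun l t x => by
      induction x using tmul_induction with
      | tmul m n => rw [lift_tmul, left_smul_tmul, lift_tmul, smul_tmul]
      | add x y hx hy => rw [smul_add, map_add, hx, hy, map_add])

/-- `assocFun` as an isometry. -/
def assocHom (L : QuadBimod U T) (M : QuadBimod T S) (N : QuadBimod S R) :
    Isometry (L.tensor (M.tensor N)) ((L.tensor M).tensor N) :=
  have hl : ∀ (t : U) (l : L) (x : M.tensor N),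
      assocFun L M N (tmul (t • l) x) = t • assocFun L M N (tmul l x) := fun t l x => by
    induction x using tmul_induction with
    | tmul m n => rfl
    | add x y hx hy => simp only [tmul_add, map_add, hx, hy, smul_add]
  have hB : ∀ (l l' : L) (x y : M.tensor N),
      ((L.tensor M).tensor N).form (assocFun L M N (tmul l x)) (assocFun L M N (tmul l' y)) =
        (M.tensor N).form x (L.form l l' • y) := fun l l' x y => by
    induction x using tmul_induction with
    | tmul m n =>
      induction y using tmul_induction with
      | tmul m' n' => rfl
      | add x y hx hy => simp only [tmul_add, map_add, hx, hy, smul_add]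
    | add x y hx hy => simp only [tmul_add, map_add, AddMonoidHom.add_apply, hx, hy]
  Isometry.ofTensor (assocFun L M N) hl
    (fun r l x => by
      induction x using tmul_induction with
      | tmul m n => rfl
      | add x y hx hy => simp only [tmul_add, map_add, hx, hy, smul_add])
    hB
    (fun a l x => by
      induction x using tmul_induction with
      | tmul m n => rfl
      | add x y hx hy =>
        rw [tmul_add, map_add, q_add_right, q_add_right, hx, hy, HermBimod.polar_apply,
          HermBimod.polar_apply, ← hl, hB]
        exact congrArg (fun t => _ + R.phi ((M.tensor N).form x (t • y)))
          (L.quad.tr_apply a l).symm)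

/-- The additive map `(l ⊗ m) ⊗ n ↦ l ⊗ (m ⊗ n)`. -/
def assocInv (L : QuadBimod U T) (M : QuadBimod T S) (N : QuadBimod S R) :
    (L.tensor M).tensor N →+ L.tensor (M.tensor N) :=
  lift (fun x n => lift (fun l m => tmul l (tmul m n))
      (fun l l' m => add_tmul _ _ _) (fun m n n' => by rw [add_tmul, tmul_add])
      (fun l t m => by rw [smul_tmul, left_smul_tmul]) x)
    (fun x y n => map_add _ _ _)
    (fun x n n' => by
      induction x using tmul_induction with
      | tmul l m => simp only [lift_tmul, tmul_add]
      | add x y hx hy => simp only [map_add, hx, hy]; abel)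
    (fun x s n => by
      induction x using tmul_induction with
      | tmul l m => rw [right_smul_tmul, lift_tmul, lift_tmul, smul_tmul]
      | add x y hx hy => rw [smul_add, map_add, hx, hy, map_add])

/-- The isometry `L ⊗ (M ⊗ N) ≅ (L ⊗ M) ⊗ N`. -/
def assoc (L : QuadBimod U T) (M : QuadBimod T S) (N : QuadBimod S R) :
    L.tensor (M.tensor N) ≅ (L.tensor M).tensor N :=
  mkIso (assocHom L M N) (assocInv L M N)
    (fun x => by
      induction x using tmul_induction with
      | tmul l x =>
        induction x using tmul_induction with
        | tmul m n => rfl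
        | add x y hx hy => simp only [tmul_add, map_add, hx, hy]
      | add x y hx hy => simp only [map_add, hx, hy])
    (fun x => by
      induction x using tmul_induction with
      | tmul x n =>
        induction x using tmul_induction with
        | tmul m n => rfl
        | add x y hx hy => simp only [add_tmul, map_add, hx, hy]
      | add x y hx hy => simp only [map_add, hx, hy])

theorem assoc_tmul (L : QuadBimod U T) (M : QuadBimod T S) (N : QuadBimod S R) (l : L) (m : M)
    (n : N) : (assoc L M N).hom.hom (tmul l (tmul m n)) = tmul (tmul l m) n := rfl

theorem assoc_inv_tmul (L : QuadBimod U T) (M : QuadBimod T S) (N : QuadBimod S R) (l : L) (m : M)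
    (n : N) : (assoc L M N).inv.hom (tmul (tmul l m) n) = tmul l (tmul m n) := rfl

/-- The bicategory of quadratic algebras over `(K, AK)`: morphisms from `R` to `S` are quadratic
`S`-`R`-bimodules, the composition is the tensor product, 2-morphisms are isometries. -/
instance bicategory (K : Type v) (AK : Type w) [CommRing K] [StarRing K] [CommRing AK]
    [QuadraticRing K AK] : Bicategory (QuadAlg.{u} K AK) where
  Hom R S := QuadBimod S R
  id R := QuadBimod.one R
  comp M L := QuadBimod.tensor L M
  homCategory R S := inferInstanceAs (Category (QuadBimod S R))
  whiskerLeft M _ _ f := tensorMap f (𝟙 M)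
  whiskerRight f L := tensorMap (𝟙 L) f
  associator N M L := assoc L M N
  leftUnitor M := tensorOne M
  rightUnitor M := oneTensor M
  whiskerLeft_id _ _ := tensor_hom_ext fun _ _ => rfl
  whiskerLeft_comp _ _ _ _ _ _ := tensor_hom_ext fun _ _ => rfl
  id_whiskerLeft {R S M N} f := by
    refine tensor_hom_ext fun m r => ?_
    change tmul (f.hom m) r = tmul (f.hom (op (one.val r) • m)) (one.of 1)
    rw [f.map_smul_right, smul_tmul]
    exact congrArg (fun t : one R => tmul (f.hom m) t) (mul_one (one.val r)).symm
  comp_whiskerLeft _ _ _ _ _ := tensor_hom_ext fun l x => by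
    induction x using tmul_induction with
    | tmul m n => rfl
    | add x y hx hy => simp only [tmul_add, map_add, hx, hy]
  id_whiskerRight _ _ := tensor_hom_ext fun _ _ => rfl
  comp_whiskerRight _ _ _ := tensor_hom_ext fun _ _ => rfl
  whiskerRight_id {R S M N} f := by
    refine tensor_hom_ext fun s m => ?_
    change tmul s (f.hom m) = tmul (one.of 1) (f.hom (one.val s • m))
    rw [f.map_smul_left, ← smul_tmul]
    exact congrArg (fun t : one S => tmul t (f.hom m)) (one_mul (one.val s)).symm
  whiskerRight_comp _ _ _ := tensor_hom_ext fun x n => by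
    induction x using tmul_induction with
    | tmul l m => rfl
    | add x y hx hy => simp only [add_tmul, map_add, hx, hy]
  whisker_assoc _ _ _ _ _ := tensor_hom_ext fun l x => by
    induction x using tmul_induction with
    | tmul m n => rfl
    | add x y hx hy => simp only [tmul_add, map_add, hx, hy]
  whisker_exchange _ _ := tensor_hom_ext fun _ _ => rfl
  pentagon _ _ _ _ := tensor_hom_ext fun l x => by
    induction x using tmul_induction with
    | tmul m y =>
      induction y using tmul_induction with
      | tmul m n => rfl
      | add x y hx hy => simp only [tmul_add, map_add, hx, hy]
    | add x y hx hy => simp only [tmul_add, map_add, hx, hy]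
  triangle {R S T} M L := tensor_hom_ext (L := L) (M := (one S).tensor M) fun l x => by
    induction x using tmul_induction with
    | tmul s n => exact smul_tmul l (one.val s) n
    | add x y hx hy => simp only [tmul_add, map_add, hx, hy]

end QuadBimod

end Bicategory

/-! ### Isomorphisms over varying quadratic algebras -/

section Iso

variable {K : Type v} {AK : Type w} [CommRing K] [StarRing K] [CommRing AK] [QuadraticRing K AK]

/-- Isomorphisms of quadratic algebras over `(K, AK)`. -/
@[ext]
structure QuadAlg.Iso (S T : QuadAlg.{u} K AK) where
  toAlgEquiv : S ≃ₐ[K] T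
  mapA : S.A ≃ₗ[AK] T.A
  map_bar : ∀ s : S, toAlgEquiv (S.bar s) = T.bar (toAlgEquiv s)
  map_lam : toAlgEquiv S.lam = T.lam
  map_act : ∀ (a : S.A) (s : S), mapA (S.act a s) = T.act (mapA a) (toAlgEquiv s)
  map_phi : ∀ s : S, mapA (S.phi s) = T.phi (toAlgEquiv s)
  map_tr : ∀ a : S.A, toAlgEquiv (S.tr a) = T.tr (mapA a)

/-- The identity isomorphism. -/
def QuadAlg.Iso.refl (S : QuadAlg.{u} K AK) : S.Iso S where
  toAlgEquiv := AlgEquiv.refl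
  mapA := LinearEquiv.refl AK S.A
  map_bar _ := rfl
  map_lam := rfl
  map_act _ _ := rfl
  map_phi _ := rfl
  map_tr _ := rfl

namespace QuadBimod

/-- Isomorphisms of quadratic bimodules over isomorphisms of the quadratic algebras acting on the left
and on the right. -/
@[ext]
structure SemiIso {S S' R R' : QuadAlg.{u} K AK} (e : S.Iso S') (d : R.Iso R')
    (M : QuadBimod S R) (M' : QuadBimod S' R') where
  equiv : M ≃+ M'
  map_smul_left : ∀ (s : S) (m : M), equiv (s • m) = e.toAlgEquiv s • equiv m
  map_smul_right : ∀ (r : R) (m : M), equiv (op r • m) = op (d.toAlgEquiv r) • equiv m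
  form_map : ∀ m m' : M, M'.form (equiv m) (equiv m') = d.toAlgEquiv (M.form m m')
  q_map : ∀ (a : S.A) (m : M), M'.q (e.mapA a) (equiv m) = d.mapA (M.q a m)

/-- The map `l ⊗ m ↦ f l ⊗ g m` between tensor products. -/
def SemiIso.tensorMap {T T' S S' R R' : QuadAlg.{u} K AK} {c : T.Iso T'} {e : S.Iso S'}
    {d : R.Iso R'} {L : QuadBimod T S} {L' : QuadBimod T' S'} {M : QuadBimod S R}
    {M' : QuadBimod S' R'} (f : SemiIso c e L L') (g : SemiIso e d M M') :
    L.tensor M →+ L'.tensor M' :=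
  lift (fun l m => tmul (f.equiv l) (g.equiv m))
    (fun l l' m => by rw [map_add, add_tmul]) (fun l m m' => by rw [map_add, tmul_add])
    (fun l s m => by rw [f.map_smul_right, smul_tmul, g.map_smul_left])

end QuadBimod

/-- The unit of an adjunction `(Q, P)` in the bicategory of quadratic bimodules, as an isometry
`S → P ⊗ Q`. -/
def adjUnit {S R : QuadAlg.{u} K AK} {Q : S ⟶ R} {P : R ⟶ S} (adj : Bicategory.Adjunction Q P) :
    QuadBimod.Isometry (QuadBimod.one S) (QuadBimod.tensor P Q) := adj.unit

/-- The counit of an adjunction `(Q, P)` in the bicategory of quadratic bimodules, as an isometry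
`Q ⊗ P → R`. -/
def adjCounit {S R : QuadAlg.{u} K AK} {Q : S ⟶ R} {P : R ⟶ S} (adj : Bicategory.Adjunction Q P) :
    QuadBimod.Isometry (QuadBimod.tensor Q P) (QuadBimod.one R) := adj.counit

/-- Isomorphisms between an adjunction `(Q, P)` of a quadratic `R`-`S`-bimodule and a quadratic
`S`-`R`-bimodule and an adjunction `(Q', P')` of a quadratic `R`-`S'`-bimodule and a quadratic
`S'`-`R`-bimodule: an isomorphism `S ≅ S'` of quadratic algebras and isomorphisms `P ≅ P'`, `Q ≅ Q'`
over it that commute with the units and the counits. -/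
@[ext]
structure AdjunctionIso {S S' R : QuadAlg.{u} K AK} {Q : S ⟶ R} {P : R ⟶ S} {Q' : S' ⟶ R}
    {P' : R ⟶ S'} (adj : Bicategory.Adjunction Q P) (adj' : Bicategory.Adjunction Q' P') where
  base : S.Iso S'
  right : QuadBimod.SemiIso base (QuadAlg.Iso.refl R) P P'
  left : QuadBimod.SemiIso (QuadAlg.Iso.refl R) base Q Q'
  unit_comm : ∀ s : S, right.tensorMap left ((adjUnit adj).hom (QuadBimod.one.of s)) =
    (adjUnit adj').hom (QuadBimod.one.of (base.toAlgEquiv s))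
  counit_comm : ∀ x : QuadBimod.tensor Q P,
    (adjCounit adj').hom (left.tensorMap right x) = (adjCounit adj).hom x

end Iso

/-! ### Quadratic structures on endomorphism rings -/

section Endomorphisms

variable {K : Type v} {AK : Type w} [CommRing K] [StarRing K] [CommRing AK] [QuadraticRing K AK]
  (R : QuadAlg.{u} K AK) (P : Type u) [AddCommGroup P] [Module (R : Type u)ᵐᵒᵖ P]

/-- A right `R`-module is fully projective if it is finitely generated projective and `R` is a direct
summand of a finite power of it. -/
structure IsFullyProjective : Prop where
  finite : Module.Finite (R : Type u)ᵐᵒᵖ P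
  projective : Module.Projective (R : Type u)ᵐᵒᵖ P
  summand : ∃ (n : ℕ) (i : R →ₗ[(R : Type u)ᵐᵒᵖ] (Fin n → P)) (p : (Fin n → P) →ₗ[(R : Type u)ᵐᵒᵖ] R),
    p ∘ₗ i = LinearMap.id

/-- The endomorphism ring of a right `R`-module `P` as a `K`-algebra: an element `k` of `K` acts on `P`
as the right multiplication by the image of `k` in `R`. -/
@[reducible]
def endAlgebra : Algebra K (Module.End (R : Type u)ᵐᵒᵖ P) :=
  letI : Module K P := Module.compHom P (algebraMap K (R : Type u)ᵐᵒᵖ)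
  haveI : IsScalarTower K (R : Type u)ᵐᵒᵖ P := ⟨fun k r p => by
    rw [Algebra.smul_def, mul_smul]; rfl⟩
  Module.End.instAlgebra K (R : Type u)ᵐᵒᵖ P

attribute [local instance] endAlgebra

variable {R P} (B : P →+ P →+ R)

/-- A structure of a quadratic algebra over `(K, AK)` on `End_R(P)` such that `B` is a hermitian form on
the `End_R(P)`-`R`-bimodule `P`, together with a quadratic form on `(P, B)`. -/
structure EndQuadraticStructure : Type (max (u + 1) w) where
  A : Type u
  [addCommGroup : AddCommGroup A]
  [module : Module AK A]
  str : QuadraticAlgebraStructure K AK (Module.End (R : Type u)ᵐᵒᵖ P) A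
  q : A → P → R.A
  herm : IsHermitian str.inv R.str.inv B
  quad : IsQuadraticForm str R.str B q

namespace EndQuadraticStructure

variable {B} (X : EndQuadraticStructure B)

/-- `End_R(P)` as a quadratic algebra. -/
def alg : QuadAlg.{u} K AK :=
  letI := X.addCommGroup
  letI := X.module
  { carrier := Module.End (R : Type u)ᵐᵒᵖ P
    A := X.A
    str := X.str }

/-- `P` as a quadratic `End_R(P)`-`R`-bimodule. -/
def bimod : QuadBimod X.alg R :=
  letI : Module X.alg P := inferInstanceAs (Module (Module.End (R : Type u)ᵐᵒᵖ P) P)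
  haveI : SMulCommClass X.alg (R : Type u)ᵐᵒᵖ P :=
    inferInstanceAs (SMulCommClass (Module.End (R : Type u)ᵐᵒᵖ P) (R : Type u)ᵐᵒᵖ P)
  { carrier := P
    central := fun _ _ => rfl
    form := B
    herm := X.herm
    q := X.q
    quad := X.quad }

/-- `P` has a left adjoint in the bicategory of quadratic bimodules. -/
def HasLeftAdjoint : Prop :=
  Bicategory.IsRightAdjoint (B := QuadAlg.{u} K AK) X.bimod

end EndQuadraticStructure

end Endomorphisms

/-! An adjunction between Q and P amounts to an isometric pairing ε : Q ⊗ P → R and a copairing x =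
η(1) in P ⊗ Q that acts as the identity on P and on Q, where (p ⊗ q) p' = p ε(q ⊗ p'). Since ε is an
isometry, this action is compatible with the forms: B(y p, z p') = B(p, B(y, z) p') and q(q(a, y),
p) = q(a, y p) (`form_apply`, `q_apply`). Since η is an isometry, B(x, s x) = s and q(a, x) = a.

The last identity shows that an element a of the quadratic structure of S is determined by tr a and
the form q(a, -) on P (`Duality.quadratic_ext`). Conversely, take a symmetric s in S and a quadratic
form f on P with polarization φ(B(p, s p')) and trace B(p, s p). Such an f extends to P ⊗ Q, and the
value of the extension at x is an element of the quadratic structure of S that induces (s, f)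
(`Duality.exists_quadratic`). A left adjoint therefore forces the quadratic structure to be the
group of all such pairs. The pseudo-involution and its symmetry are forced by nondegeneracy of B.
This gives the uniqueness in the first part.

For existence, the group `quadraticForms` of all these pairs is taken as the quadratic structure on
End(P). The left adjoint is P itself with both actions twisted by the pseudo-involutions; the
pairing is the inverse conjugate of B, and a dual basis of P gives the copairing (`dualDuality`).

For an adjoint equivalence, surjectivity of η shows that every endomorphism of P comes from S.
Surjectivity of ε gives 1 = ∑ ε(qᵢ ⊗ pᵢ), hence full projectivity, and it turns every linear form on
P into some B(w, -). For a second left adjoint over End(P), the unit is bijective because every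
endomorphism comes from the ring. The counit is bijective by the Morita identity y ε(z) = ε(y) z,
once 1 is in its image. Finally, the identity of P determines the whole isomorphism of adjunctions:
the rings are compared by their actions, the quadratic structures by traces and forms, and Q with Q'
by their pairings with P. -/

theorem leftZigzag_eq {B : Type*} [Bicategory B] {a b : B} {f : a ⟶ b} {g : b ⟶ a}
    (η : 𝟙 a ⟶ f ≫ g) (ε : g ≫ f ⟶ 𝟙 b) : Bicategory.leftZigzag η ε =
      Bicategory.whiskerRight η f ≫ (Bicategory.associator f g f).hom ≫
        Bicategory.whiskerLeft f ε := by
  simp [bicategoricalComp]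

theorem rightZigzag_eq {B : Type*} [Bicategory B] {a b : B} {f : a ⟶ b} {g : b ⟶ a}
    (η : 𝟙 a ⟶ f ≫ g) (ε : g ≫ f ⟶ 𝟙 b) : Bicategory.rightZigzag η ε =
      Bicategory.whiskerLeft g η ≫ (Bicategory.associator g f g).inv ≫
        Bicategory.whiskerRight ε g := by
  simp [bicategoricalComp]

/-! ### Adjunctions in terms of elements: pairing and copairing -/

section Duality

variable {K : Type v} {AK : Type w} [CommRing K] [StarRing K] [CommRing AK] [QuadraticRing K AK]
  {T S R : QuadAlg.{u} K AK}

namespace QuadBimod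

/-- The pairing `Q × P → R` given by an isometry `Q ⊗ P → R`. -/
def pair {P : QuadBimod S R} {Q : QuadBimod R S} (ε : Isometry (Q.tensor P) (one R)) :
    Q →+ P →+ R :=
  AddMonoidHom.mk' (fun q => AddMonoidHom.mk' (fun p => one.val (ε.hom (tmul q p)))
      (fun p p' => by rw [tmul_add, map_add]; rfl))
    (fun q q' => by
      ext p
      change one.val (ε.hom (tmul (q + q') p)) = _
      rw [add_tmul, map_add]; rfl)

section Pair

variable {P : QuadBimod S R} {Q : QuadBimod R S} (ε : Isometry (Q.tensor P) (one R))

theorem pair_smul_left (r : R) (q : Q) (p : P) : pair ε (r • q) p = r * pair ε q p :=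
  ε.map_smul_left r (tmul q p)

theorem pair_smul_right (r : R) (q : Q) (p : P) : pair ε q (op r • p) = pair ε q p * r :=
  ε.map_smul_right r (tmul q p)

theorem pair_op_smul (s : S) (q : Q) (p : P) : pair ε (op s • q) p = pair ε q (s • p) :=
  congrArg (fun x => one.val (ε.hom x)) (smul_tmul q s p)

theorem bar_pair_mul_pair (q q' : Q) (p p' : P) :
    R.bar (pair ε q p) * pair ε q' p' = P.form p (Q.form q q' • p') :=
  ε.form_map (tmul q p) (tmul q' p')

theorem act_pair (a : R.A) (q : Q) (p : P) : R.act a (pair ε q p) = P.q (Q.q a q) p :=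
  ε.q_map a (tmul q p)

/-- The right linear form `p ↦ ε (q ⊗ p)`. -/
def pairLinear (q : Q) : P →ₗ[(R : Type u)ᵐᵒᵖ] R where
  toFun := pair ε q
  map_add' := map_add _
  map_smul' r p := pair_smul_right ε r.unop q p

/-- The map `p ⊗ q ↦ f p ⊗ q` for a right linear map `f`. -/
def mapLeft {P' : QuadBimod T R} (f : P →ₗ[(R : Type u)ᵐᵒᵖ] P') (Q : QuadBimod R S) :
    P.tensor Q →+ P'.tensor Q :=
  lift (fun p q => tmul (f p) q) (fun p p' q => by rw [map_add, add_tmul])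
    (fun p q q' => by rw [tmul_add]) (fun p r q => by rw [map_smul, smul_tmul])

theorem mapLeft_tmul {P' : QuadBimod T R} (f : P →ₗ[(R : Type u)ᵐᵒᵖ] P') (p : P) (q : Q) :
    mapLeft f Q (tmul p q) = tmul (f p) q := rfl

/-- The map `p ⊗ q ↦ f p q` for a right linear form `f`. -/
def contract (f : P →ₗ[(R : Type u)ᵐᵒᵖ] R) (Q : QuadBimod R T) : P.tensor Q →+ Q :=
  lift (fun p q => f p • q) (fun p p' q => by rw [map_add, add_smul])
    (fun p q q' => by rw [smul_add])
    (fun p r q => by rw [map_smul, op_smul_eq_mul, mul_smul])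

theorem contract_tmul (f : P →ₗ[(R : Type u)ᵐᵒᵖ] R) {Q : QuadBimod R T} (p : P) (q : Q) :
    contract f Q (tmul p q) = f p • q := rfl

/-- The action of `P ⊗ Q` on `P` by `(p ⊗ q) p' = p ε (q ⊗ p')`. -/
def apply : P.tensor Q →+ P →+ P :=
  lift (fun p q => AddMonoidHom.mk' (fun p' => op (pair ε q p') • p)
      (fun x y => by rw [map_add, MulOpposite.op_add, add_smul]))
    (fun p p' q => by ext x; exact smul_add _ _ _)
    (fun p q q' => by
      ext x
      change op (pair ε (q + q') x) • p = _
      rw [map_add, AddMonoidHom.add_apply, MulOpposite.op_add, add_smul]; rfl)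
    (fun p r q => by
      ext x
      change op (pair ε q x) • op r • p = op (pair ε (r • q) x) • p
      rw [pair_smul_left, op_mul, mul_smul])

theorem apply_tmul (p p' : P) (q : Q) : apply ε (tmul p q) p' = op (pair ε q p') • p := rfl

theorem apply_smul_left (s : S) (x : P.tensor Q) (p : P) :
    apply ε (s • x) p = s • apply ε x p := by
  induction x using tmul_induction with
  | tmul p' q => rw [left_smul_tmul, apply_tmul, apply_tmul]; exact (smul_comm _ _ _).symm
  | add x y hx hy => simp only [smul_add, map_add, AddMonoidHom.add_apply, hx, hy]

theorem apply_op_smul (s : S) (x : P.tensor Q) (p : P) :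
    apply ε (op s • x) p = apply ε x (s • p) := by
  induction x using tmul_induction with
  | tmul p' q => rw [right_smul_tmul, apply_tmul, apply_tmul, pair_op_smul]
  | add x y hx hy => simp only [smul_add, map_add, AddMonoidHom.add_apply, hx, hy]

theorem apply_smul_right (x : P.tensor Q) (r : R) (p : P) :
    apply ε x (op r • p) = op r • apply ε x p := by
  induction x using tmul_induction with
  | tmul p' q => rw [apply_tmul, apply_tmul, pair_smul_right, op_mul, mul_smul]
  | add x y hx hy => simp only [smul_add, map_add, AddMonoidHom.add_apply, hx, hy]

/-- `apply` as a right linear map. -/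
def applyLinear (x : P.tensor Q) : P →ₗ[(R : Type u)ᵐᵒᵖ] P where
  toFun := apply ε x
  map_add' := map_add _
  map_smul' r p := apply_smul_right ε x r.unop p

/-- On pure tensors both sides equal bar ε(q₁ ⊗ p) · B(p₁, p₂) · ε(q₂ ⊗ p'): the left one by
sesquilinearity of B, the right one because ε is an isometry. Hence B on P ⊗ Q is controlled by the
action on P. -/
theorem form_apply (x y : P.tensor Q) (p p' : P) :
    P.form (apply ε x p) (apply ε y p') = P.form p ((P.tensor Q).form x y • p') := by
  induction x using tmul_induction with
  | add x y hx hy => simp only [map_add, AddMonoidHom.add_apply, add_smul, hx, hy]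
  | tmul p₁ q₁ =>
    induction y using tmul_induction with
    | add x y hx hy => simp only [map_add, AddMonoidHom.add_apply, add_smul, hx, hy]
    | tmul p₂ q₂ =>
      rw [apply_tmul, apply_tmul, form_tmul, ← bar_pair_mul_pair ε, pair_smul_left, ← mul_assoc]
      exact P.herm.sesquilinear _ _ _ _

/-- On pure tensors this is the compatibility of ε with the quadratic forms. For sums, the
polarization terms agree by `form_apply`. -/
theorem q_apply (a : S.A) (x : P.tensor Q) (p : P) :
    P.q ((P.tensor Q).q a x) p = P.q a (apply ε x p) := by
  induction x using tmul_induction with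
  | tmul p₁ q₁ => rw [q_tmul, ← act_pair ε, apply_tmul, P.quad.smul_right]
  | add x y hx hy =>
    rw [q_add_right, P.quad.add_left, P.quad.add_left, hx, hy, map_add, AddMonoidHom.add_apply,
      q_add_right, HermBimod.polar_apply, HermBimod.polar_apply, ← apply_smul_left, form_apply]
    exact congrArg _ (P.quad.phi_left _ _)

theorem pair_contract (f : P →ₗ[(R : Type u)ᵐᵒᵖ] R) (x : P.tensor Q) (p : P) :
    pair ε (contract f Q x) p = f (apply ε x p) := by
  induction x using tmul_induction with
  | tmul p' q => rw [contract_tmul, apply_tmul, f.map_smul, pair_smul_left, op_smul_eq_mul]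
  | add x y hx hy => simp only [map_add, AddMonoidHom.add_apply, hx, hy]

theorem apply_mapLeft (f : P →ₗ[(R : Type u)ᵐᵒᵖ] P) (x : P.tensor Q) (p : P) :
    apply ε (mapLeft f Q x) p = f (apply ε x p) := by
  induction x using tmul_induction with
  | tmul p' q => rw [mapLeft_tmul, apply_tmul, apply_tmul, map_smul]
  | add x y hx hy => simp only [map_add, AddMonoidHom.add_apply, hx, hy]

/-- The left side is the product of p ⊗ q with x, since p ε(q ⊗ p') ⊗ q' = p ⊗ ε(q ⊗ p') q'; it only
depends on how p ⊗ q acts on P. With the copairing as x, the left side is p ⊗ q itself, which is how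
p ⊗ q becomes a multiple of the copairing. -/
theorem tmul_contract_pairLinear (p : P) (q : Q) (x : P.tensor Q) (s : S)
    (h : ∀ p', s • p' = apply ε (tmul p q) p') :
    tmul p (contract (pairLinear ε q) Q x) = s • x := by
  induction x using tmul_induction with
  | tmul p' q' =>
    rw [contract_tmul, ← smul_tmul, left_smul_tmul, h]; rfl
  | add x y hx hy => simp only [map_add, tmul_add, smul_add, hx, hy]

end Pair

/-- The data of an adjunction `(Q, P)` in the bicategory of quadratic bimodules in terms of
elements. -/
structure Duality (P : QuadBimod S R) (Q : QuadBimod R S) where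
  unit : Isometry (one S) (P.tensor Q)
  counit : Isometry (Q.tensor P) (one R)
  apply_unit : ∀ p : P, apply counit (unit.hom (one.of 1)) p = p
  contract_unit : ∀ q : Q, contract (pairLinear counit q) Q (unit.hom (one.of 1)) = q

/-- The left zigzag of isometries `S → P ⊗ Q` and `Q ⊗ P → R`. -/
def zigzagLeft {P : QuadBimod S R} {Q : QuadBimod R S}
    (η : Isometry (one S) (P.tensor Q)) (ε : Isometry (Q.tensor P) (one R)) :
    Q.tensor (one S) ⟶ (one R).tensor Q :=
  tensorMap (𝟙 Q) (show one S ⟶ P.tensor Q from η) ≫ (assoc Q P Q).hom ≫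
    tensorMap (show Q.tensor P ⟶ one R from ε) (𝟙 Q)

/-- The right zigzag of isometries `S → P ⊗ Q` and `Q ⊗ P → R`. -/
def zigzagRight {P : QuadBimod S R} {Q : QuadBimod R S}
    (η : Isometry (one S) (P.tensor Q)) (ε : Isometry (Q.tensor P) (one R)) :
    (one S).tensor P ⟶ P.tensor (one R) :=
  tensorMap (show one S ⟶ P.tensor Q from η) (𝟙 P) ≫ (assoc P Q P).inv ≫
    tensorMap (𝟙 P) (show Q.tensor P ⟶ one R from ε)

theorem zigzagLeft_tmul {P : QuadBimod S R} {Q : QuadBimod R S}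
    (η : Isometry (one S) (P.tensor Q)) (ε : Isometry (Q.tensor P) (one R)) (q : Q) (s : S) :
    (oneTensor Q).hom.hom ((zigzagLeft η ε).hom (tmul q (one.of s))) =
      contract (pairLinear ε q) Q (η.hom (one.of s)) := by
  change (oneTensor Q).hom.hom (Isometry.hom (tensorMap (show Q.tensor P ⟶ one R from ε) (𝟙 Q))
    ((assoc Q P Q).hom.hom (tmul q (η.hom (one.of s))))) = _
  -- Only the image of s in P ⊗ Q matters and both sides are additive in it, so it may be replaced
  -- by an arbitrary element and then by a pure tensor.
  generalize η.hom (one.of s) = x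
  induction x using tmul_induction with
  | tmul p q' => rfl
  | add x y hx hy => simp only [tmul_add, map_add, hx, hy]

theorem zigzagRight_tmul {P : QuadBimod S R} {Q : QuadBimod R S}
    (η : Isometry (one S) (P.tensor Q)) (ε : Isometry (Q.tensor P) (one R)) (p : P) (s : S) :
    (tensorOne P).hom.hom ((zigzagRight η ε).hom (tmul (one.of s) p)) =
      apply ε (η.hom (one.of s)) p := by
  change (tensorOne P).hom.hom (Isometry.hom (tensorMap (𝟙 P) (show Q.tensor P ⟶ one R from ε))
    ((assoc P Q P).inv.hom (tmul (η.hom (one.of s)) p))) = _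
  generalize η.hom (one.of s) = x
  induction x using tmul_induction with
  | tmul p q' => rfl
  | add x y hx hy => simp only [add_tmul, map_add, hx, hy, AddMonoidHom.add_apply]

/-- An adjunction in the bicategory of quadratic bimodules in terms of elements. -/
def Duality.ofAdjunction {P : QuadBimod S R} {Q : QuadBimod R S}
    (adj : Bicategory.Adjunction (B := QuadAlg.{u} K AK) (a := S) (b := R) Q P) :
    Duality P Q where
  unit := adjUnit adj
  counit := adjCounit adj
  apply_unit p := by
    have h : zigzagRight (adjUnit adj) (adjCounit adj) = (oneTensor P).hom ≫ (tensorOne P).inv :=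
      (rightZigzag_eq _ _).symm.trans adj.right_triangle
    rw [← zigzagRight_tmul, h]
    exact (one_smul _ _).trans (one_smul _ _)
  contract_unit q := by
    have h : zigzagLeft (adjUnit adj) (adjCounit adj) = (tensorOne Q).hom ≫ (oneTensor Q).inv :=
      (leftZigzag_eq _ _).symm.trans adj.left_triangle
    rw [← zigzagLeft_tmul, h]
    exact (one_smul _ _).trans (one_smul _ _)

namespace Duality

variable {P : QuadBimod S R} {Q : QuadBimod R S} (D : Duality P Q)

/-- The image of `1` under the unit. -/
def copair : P.tensor Q := D.unit.hom (one.of 1)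

theorem apply_copair (p : P) : apply D.counit D.copair p = p := D.apply_unit p

theorem contract_copair (q : Q) : contract (pairLinear D.counit q) Q D.copair = q :=
  D.contract_unit q

theorem unit_of (s : S) : D.unit.hom (one.of s) = s • D.copair := by
  rw [copair, ← D.unit.map_smul_left]
  exact congrArg D.unit.hom (mul_one s).symm

theorem unit_of' (s : S) : D.unit.hom (one.of s) = op s • D.copair := by
  rw [copair, ← D.unit.map_smul_right]
  exact congrArg D.unit.hom (one_mul s).symm

theorem apply_unit_of (s : S) (p : P) : apply D.counit (D.unit.hom (one.of s)) p = s • p := by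
  rw [unit_of, apply_smul_left, apply_copair]

/-- The adjunction given by a duality. -/
def toAdjunction :
    Bicategory.Adjunction (B := QuadAlg.{u} K AK) (a := S) (b := R) Q P where
  unit := D.unit
  counit := D.counit
  left_triangle := by
    refine (leftZigzag_eq _ _).trans ?_
    change zigzagLeft D.unit D.counit = (tensorOne Q).hom ≫ (oneTensor Q).inv
    rw [Iso.eq_comp_inv]
    refine tensor_hom_ext fun q s => ?_
    refine (zigzagLeft_tmul D.unit D.counit q s).trans ?_
    -- Contraction commutes with the right action of S. It is applied to the unit written as the
    -- copairing times s, so that only the triangle identity at 1 is needed.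
    have h : ∀ x : P.tensor Q, contract (pairLinear D.counit q) Q (op (one.val s) • x) =
        op (one.val s) • contract (pairLinear D.counit q) Q x := fun x => by
      induction x using tmul_induction with
      | tmul p q' => exact smul_comm _ _ _
      | add x y hx hy => simp only [smul_add, map_add, hx, hy]
    refine (congrArg _ (D.unit_of' (one.val s))).trans ((h _).trans ?_)
    rw [contract_copair]
    rfl
  right_triangle := by
    refine (rightZigzag_eq _ _).trans ?_
    change zigzagRight D.unit D.counit = (oneTensor P).hom ≫ (tensorOne P).inv
    rw [Iso.eq_comp_inv]
    refine tensor_hom_ext fun s p => ?_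
    exact (zigzagRight_tmul D.unit D.counit p s).trans (D.apply_unit_of _ p)

/-- An element q is recovered from its linear form ε(q ⊗ -) by contracting that form with the
copairing. -/
theorem pair_ext (D : Duality P Q) {q q' : Q}
    (h : ∀ p, pair D.counit q p = pair D.counit q' p) : q = q' := by
  have e : pairLinear D.counit q = pairLinear D.counit q' := LinearMap.ext h
  rw [← D.contract_copair q, e, D.contract_copair]

theorem form_copair (s : S) : (P.tensor Q).form D.copair (s • D.copair) = s := by
  rw [← D.unit_of, copair, D.unit.form_map]
  exact (one_form 1 s).trans (by rw [QuadAlg.bar, S.str.inv.bar_one, one_mul])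

/-- S acts on P ⊗ Q through the factor P, and s is recovered from its action there as B(x, s x) for
the copairing x. -/
theorem smul_ext (D : Duality P Q) {s s' : S} (h : ∀ p : P, s • p = s' • p) : s = s' := by
  have e : ∀ x : P.tensor Q, s • x = s' • x := fun x => by
    induction x using tmul_induction with
    | tmul p q => rw [left_smul_tmul, h, left_smul_tmul]
    | add x y hx hy => rw [smul_add, hx, hy, smul_add]
  rw [← D.form_copair s, e, D.form_copair]

theorem q_copair (a : S.A) : (P.tensor Q).q a D.copair = a :=
  (D.unit.q_map a (one.of 1)).trans (S.str.qs.act_one a)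

/-- The unit is an isometry, so a = q(a, x) for the copairing x. The quadratic form of P ⊗ Q depends
on a through q(a, -) on pure tensors and through tr a in the polarization, which is why both have to
agree. -/
theorem quadratic_ext (D : Duality P Q) {a b : S.A} (htr : S.tr a = S.tr b)
    (h : ∀ p, P.q a p = P.q b p) :
    a = b := by
  have e : ∀ x : P.tensor Q, (P.tensor Q).q a x = (P.tensor Q).q b x := fun x => by
    induction x using tmul_induction with
    | tmul p q => rw [q_tmul, q_tmul, h]
    | add x y hx hy =>
      rw [q_add_right, q_add_right, hx, hy, HermBimod.polar_apply, HermBimod.polar_apply, htr]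
  rw [← D.q_copair a, e, D.q_copair]

end Duality

end QuadBimod

end Duality

/-! ### Identities for pseudo-involutions and quadratic rings -/

section PseudoInvolutionLemmas

namespace PseudoInvolution

variable {K R : Type*} [CommRing K] [StarRing K] [Ring R] [Algebra K R] (σ : PseudoInvolution K R)

theorem bar_lam_mul_lam : σ.bar σ.lam * (σ.lam : R) = 1 := by
  have h := σ.bar_bar 1
  rw [σ.bar_one, σ.bar_one, mul_one] at h
  rw [Units.eq_inv_of_mul_eq_one_left h.symm, σ.lam.inv_mul]

theorem lam_mul_bar_lam : (σ.lam : R) * σ.bar σ.lam = 1 := by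
  have h := σ.bar_bar 1
  rw [σ.bar_one, σ.bar_one, mul_one] at h
  exact h.symm

theorem bar_bar_mul_lam (r : R) : σ.bar (σ.bar r) * σ.lam = σ.lam * r := by
  rw [σ.bar_bar, mul_assoc, bar_lam_mul_lam, mul_one]

/-- The map r ↦ bar r · λ is a genuine involution of the additive group, although bar need not be
one. Its fixed elements are the symmetric ones in which traces lie. -/
theorem bar_mul_lam_twice (r : R) : σ.bar (σ.bar r * σ.lam) * σ.lam = r := by
  rw [σ.bar_mul, mul_assoc, bar_bar_mul_lam, ← mul_assoc, bar_lam_mul_lam, one_mul]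

theorem bar_conj_mul_lam (x t y : R) :
    σ.bar (σ.bar x * t * y) * σ.lam = σ.bar y * (σ.bar t * σ.lam) * x := by
  rw [σ.bar_mul, σ.bar_mul, mul_assoc, mul_assoc, bar_bar_mul_lam]
  simp only [mul_assoc]

theorem bar_injective : Function.Injective σ.bar := fun r r' h => by
  have e := congrArg σ.bar h
  -- Since bar λ is the inverse of λ, this expression undoes the conjugation by λ that is the square
  -- of bar.
  have := congrArg (fun t => σ.bar σ.lam * (t * σ.lam)) e
  simpa only [bar_bar_mul_lam, ← mul_assoc, bar_lam_mul_lam, one_mul] using this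

/-- The inverse of a pseudo-involution. -/
def barInv : R →+ R :=
  AddMonoidHom.mk' (fun r => σ.bar σ.lam * σ.bar r * σ.lam)
    (fun r r' => by rw [map_add, mul_add, add_mul])

theorem bar_barInv (r : R) : σ.bar (σ.barInv r) = r := by
  apply σ.bar_injective
  change σ.bar (σ.bar (σ.bar σ.lam * σ.bar r * σ.lam)) = _
  rw [σ.bar_bar, ← mul_assoc, ← mul_assoc, lam_mul_bar_lam, one_mul, mul_assoc, lam_mul_bar_lam,
    mul_one]

end PseudoInvolution

end PseudoInvolutionLemmas

section QuadraticRingLemmas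

variable {K : Type v} {AK : Type w} [CommRing K] [StarRing K] [CommRing AK] [QuadraticRing K AK]

namespace QuadraticRing

theorem star_tr (c : AK) :
    star ((qs (K := K) (AK := AK)).tr c) = (qs (K := K) (AK := AK)).tr c := by
  have h := (qs (K := K) (AK := AK)).tr_symm c
  exact ((mul_one _).symm.trans h.symm)

theorem tr_phi_eq (k : K) : (qs (K := K) (AK := AK)).tr ((qs (K := K) (AK := AK)).phi k) =
    k + star k :=
  ((qs (K := K) (AK := AK)).tr_phi k).trans (congrArg (k + ·) (mul_one (star k)))

theorem tr_act_eq (c : AK) (k : K) :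
    (qs (K := K) (AK := AK)).tr ((qs (K := K) (AK := AK)).act c k) =
      star k * (qs (K := K) (AK := AK)).tr c * k :=
  (qs (K := K) (AK := AK)).tr_act c k

theorem bar_smul {R : Type*} [Ring R] [Algebra K R] (σ : PseudoInvolution K R) (k : K) (r : R) :
    σ.bar (k • r) = star k • σ.bar r := by
  rw [Algebra.smul_def, σ.bar_mul, σ.bar_algebraMap, ← Algebra.commutes, Algebra.smul_def]

end QuadraticRing

end QuadraticRingLemmas

/-! ### The universal quadratic structure: all quadratic forms on P -/

section Universal

variable {K : Type v} {AK : Type w} [CommRing K] [StarRing K] [CommRing AK] [QuadraticRing K AK]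
  {R : QuadAlg.{u} K AK} {S : Type u} [Ring S] [Algebra K S] {P : Type u} [AddCommGroup P]
  [Module S P] [Module (R : Type u)ᵐᵒᵖ P]

theorem IsHermitian.form_smul_right {σ : PseudoInvolution K S} {B : P →+ P →+ R}
    (h : IsHermitian σ R.str.inv B) (p p' : P) (r : R) : B p (op r • p') = B p p' * r := by
  simpa [R.str.inv.bar_one] using h.sesquilinear p p' 1 r

/-- Hermitian symmetry carries B(p', s p) to B(p, bar s λ p') under r ↦ bar r · λ, and φ is
invariant under this map. The identity makes polarizations symmetric and matches cross terms. -/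
theorem IsHermitian.phi_form_bar {σ : PseudoInvolution K S} {B : P →+ P →+ R}
    (h : IsHermitian σ R.str.inv B) (s : S) (p p' : P) :
    R.phi (B p ((σ.bar s * σ.lam) • p')) = R.phi (B p' (s • p)) := by
  rw [mul_smul, ← h.smul_left, h.symm]
  exact (R.str.qs.phi_bar _).symm

theorem IsHermitian.form_algebra_smul {σ : PseudoInvolution K S} {B : P →+ P →+ R}
    (h : IsHermitian σ R.str.inv B)
    (central : ∀ (k : K) (p : P), algebraMap K S k • p = op (algebraMap K R k) • p)
    (k : K) (s : S) (p p' : P) : B p ((k • s) • p') = k • B p (s • p') := by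
  rw [Algebra.smul_def, mul_smul, central, h.form_smul_right, Algebra.smul_def, Algebra.commutes]

variable (σ : PseudoInvolution K S) (B : P →+ P →+ R)

/-- The quadratic forms on `P` whose polarization is the composite of `B` with an element of `S`, as
pairs of the element of `S` and the form. -/
def quadraticForms : AddSubgroup (S × (P → R.A)) where
  carrier := {t | t.1 = σ.bar t.1 * σ.lam ∧ (∀ p (r : R), t.2 (op r • p) = R.act (t.2 p) r) ∧
    (∀ p p', t.2 (p + p') = t.2 p + R.phi (B p (t.1 • p')) + t.2 p') ∧
    ∀ p, R.tr (t.2 p) = B p (t.1 • p)}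
  zero_mem' := by
    have h : ∀ r : R, R.act 0 r = 0 := fun r => by
      have := R.str.qs.add_act 0 0 r
      rw [add_zero] at this
      exact left_eq_add.1 this
    refine ⟨by simp, fun p r => (h r).symm, fun p p' => by simp, fun p => by simp⟩
  add_mem' {t t'} h h' := by
    obtain ⟨h₁, h₂, h₃, h₄⟩ := h
    obtain ⟨h₁', h₂', h₃', h₄'⟩ := h'
    refine ⟨?_, fun p r => ?_, fun p p' => ?_, fun p => ?_⟩
    · rw [Prod.fst_add, map_add, add_mul, ← h₁, ← h₁']
    · rw [Prod.snd_add, Pi.add_apply, Pi.add_apply, h₂, h₂']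
      exact (R.str.qs.add_act _ _ _).symm
    · rw [Prod.snd_add, Pi.add_apply, Pi.add_apply, Pi.add_apply, h₃, h₃', Prod.fst_add, add_smul,
        map_add, map_add]
      abel
    · rw [Prod.snd_add, Pi.add_apply, map_add, h₄, h₄', Prod.fst_add, add_smul, map_add]
  neg_mem' {t} h := by
    obtain ⟨h₁, h₂, h₃, h₄⟩ := h
    refine ⟨?_, fun p r => ?_, fun p p' => ?_, fun p => ?_⟩
    · rw [Prod.fst_neg, map_neg, neg_mul, ← h₁]
    · have e := map_neg (AddMonoidHom.mk' (fun a => R.act a r)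
        (fun a a' => R.str.qs.add_act a a' r)) (t.2 p)
      rw [Prod.snd_neg, Pi.neg_apply, Pi.neg_apply, h₂]
      exact e.symm
    · rw [Prod.snd_neg, Pi.neg_apply, Pi.neg_apply, Pi.neg_apply, h₃, Prod.fst_neg, neg_smul,
        map_neg, map_neg]
      abel
    · rw [Prod.snd_neg, Pi.neg_apply, map_neg, h₄, Prod.fst_neg, neg_smul, map_neg]

variable {σ B}

namespace quadraticForms

theorem symm (t : quadraticForms σ B) : t.1.1 = σ.bar t.1.1 * σ.lam := t.2.1

theorem map_smul (t : quadraticForms σ B) (p : P) (r : R) :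
    t.1.2 (op r • p) = R.act (t.1.2 p) r := t.2.2.1 p r

theorem map_add (t : quadraticForms σ B) (p p' : P) :
    t.1.2 (p + p') = t.1.2 p + R.phi (B p (t.1.1 • p')) + t.1.2 p' := t.2.2.2.1 p p'

theorem tr_map (t : quadraticForms σ B) (p : P) : R.tr (t.1.2 p) = B p (t.1.1 • p) :=
  t.2.2.2.2 p

theorem ext {t t' : quadraticForms σ B} (h : t.1.1 = t'.1.1) (h' : ∀ p, t.1.2 p = t'.1.2 p) :
    t = t' := Subtype.ext (Prod.ext h (funext h'))

variable (hB : IsHermitian σ R.str.inv B)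
  (central : ∀ (k : K) (p : P), algebraMap K S k • p = op (algebraMap K R k) • p)

/-- The action of `AK` on quadratic forms. -/
@[reducible]
def module : Module AK (quadraticForms σ B) :=
  letI : SMul AK (quadraticForms σ B) := ⟨fun c t =>
    ⟨((QuadraticRing.qs (K := K) (AK := AK)).tr c • t.1.1, fun p => c • t.1.2 p), by
      refine ⟨?_, fun p r => ?_, fun p p' => ?_, fun p => ?_⟩
      · rw [QuadraticRing.bar_smul, QuadraticRing.star_tr, smul_mul_assoc, ← symm t]
      · change c • t.1.2 (op r • p) = _
        rw [map_smul]
        exact R.str.smul_act _ _ _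
      · change c • t.1.2 (p + p') = c • t.1.2 p + _ + c • t.1.2 p'
        rw [map_add, smul_add, smul_add, hB.form_algebra_smul central]
        congr 2
        exact R.str.smul_phi _ _
      · rw [hB.form_algebra_smul central, ← tr_map]
        exact R.str.tr_smul _ _⟩⟩
  have h₁ : ∀ (c : AK) (t : quadraticForms σ B),
    (c • t).1.1 = (QuadraticRing.qs (K := K) (AK := AK)).tr c • t.1.1 := fun _ _ => rfl
  have h₂ : ∀ (c : AK) (t : quadraticForms σ B) (p : P), (c • t).1.2 p = c • t.1.2 p :=
    fun _ _ _ => rfl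
  Module.ofMinimalAxioms
    (fun c t t' => ext (smul_add _ t.1.1 t'.1.1) fun p => smul_add c (t.1.2 p) (t'.1.2 p))
    (fun c c' t => ext (by
        change _ • _ = (c • t).1.1 + (c' • t).1.1
        rw [h₁, h₁, _root_.map_add, add_smul])
      fun p => add_smul c c' (t.1.2 p))
    (fun c c' t => ext (by rw [h₁, h₁, h₁, QuadraticRing.tr_mul, mul_smul])
      fun p => mul_smul c c' (t.1.2 p))
    (fun t => ext (by rw [h₁, QuadraticRing.tr_one, one_smul]) fun p => one_smul AK (t.1.2 p))

variable [SMulCommClass S (R : Type u)ᵐᵒᵖ P]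

/-- The pullback of a quadratic form along the action of an element of `S`. -/
def act (hB : IsHermitian σ R.str.inv B) (t : quadraticForms σ B) (x : S) : quadraticForms σ B :=
  ⟨(σ.bar x * t.1.1 * x, fun p => t.1.2 (x • p)), by
    refine ⟨?_, fun p r => ?_, fun p p' => ?_, fun p => ?_⟩
    · rw [σ.bar_conj_mul_lam, ← symm t]
    · change t.1.2 (x • op r • p) = _
      rw [smul_comm, map_smul]
    · change t.1.2 (x • (p + p')) = _
      rw [smul_add, map_add, hB.smul_left, mul_assoc, mul_smul, mul_smul]
    · change R.tr (t.1.2 (x • p)) = _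
      rw [tr_map, hB.smul_left, mul_assoc, mul_smul, mul_smul]⟩

/-- The quadratic form `p ↦ phi (B (p, s p))`. -/
def phi (hB : IsHermitian σ R.str.inv B) : S →+ quadraticForms σ B :=
  AddMonoidHom.mk' (fun s => ⟨(s + σ.bar s * σ.lam, fun p => R.phi (B p (s • p))), by
      refine ⟨?_, fun p r => ?_, fun p p' => ?_, fun p => ?_⟩
      · rw [_root_.map_add, add_mul, σ.bar_mul_lam_twice, add_comm]
      · change R.phi (B (op r • p) (s • op r • p)) = _
        rw [smul_comm, hB.sesquilinear]
        exact R.str.qs.phi_act _ _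
      · change R.phi (B (p + p') (s • (p + p'))) = R.phi (B p (s • p)) + _ + R.phi (B p' (s • p'))
        -- The polarization belongs to s + bar s λ; its second summand becomes φ(B(p', s p)), which
        -- is the other cross term of φ(B(p + p', s (p + p'))).
        rw [add_smul, _root_.map_add (B p), _root_.map_add R.phi, hB.phi_form_bar]
        simp only [smul_add, _root_.map_add, AddMonoidHom.add_apply]
        abel
      · change R.tr (R.phi (B p (s • p))) = _
        rw [add_smul, mul_smul, _root_.map_add, ← hB.smul_left, hB.symm]
        exact R.str.qs.tr_phi _⟩)
    (fun s s' => ext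
      (by
        change s + s' + σ.bar (s + s') * σ.lam = s + σ.bar s * σ.lam + (s' + σ.bar s' * σ.lam)
        rw [_root_.map_add, add_mul]; abel)
      (fun p => by
        change R.phi (B p ((s + s') • p)) = R.phi (B p (s • p)) + R.phi (B p (s' • p))
        rw [add_smul, _root_.map_add, _root_.map_add]))

/-- The structure of a quadratic algebra given by the quadratic forms on `P`. -/
def str : letI := module hB central
    QuadraticAlgebraStructure K AK S (quadraticForms σ B) :=
  letI := module hB central
  { inv := σ
    qs :=
      { act := act hB
        add_act := fun t t' x => ext
          (by
            change σ.bar x * (t.1.1 + t'.1.1) * x = σ.bar x * t.1.1 * x + σ.bar x * t'.1.1 * x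
            rw [mul_add, add_mul])
          (fun p => rfl)
        act_one := fun t => ext
          (by
            change σ.bar 1 * t.1.1 * 1 = t.1.1
            rw [σ.bar_one, one_mul, mul_one])
          (fun p => congrArg t.1.2 (one_smul S p))
        act_mul := fun t x y => ext
          (by
            change σ.bar (x * y) * t.1.1 * (x * y) = σ.bar y * (σ.bar x * t.1.1 * x) * y
            rw [σ.bar_mul]; simp only [mul_assoc])
          (fun p => congrArg t.1.2 (mul_smul x y p))
        phi := phi hB
        tr := AddMonoidHom.mk' (fun t => t.1.1) (fun _ _ => rfl)
        phi_act := fun x y => ext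
          (by
            change σ.bar y * x * y + σ.bar (σ.bar y * x * y) * σ.lam =
              σ.bar y * (x + σ.bar x * σ.lam) * y
            rw [σ.bar_conj_mul_lam, mul_add, add_mul])
          (fun p => by
            change R.phi (B p ((σ.bar y * x * y) • p)) = R.phi (B (y • p) (x • y • p))
            rw [hB.smul_left, mul_assoc, mul_smul, mul_smul])
        tr_act := fun t x => rfl
        phi_bar := fun x => ext
          (by
            change x + σ.bar x * σ.lam = σ.bar x * σ.lam + σ.bar (σ.bar x * σ.lam) * σ.lam
            rw [σ.bar_mul_lam_twice, add_comm])
          (fun p => (hB.phi_form_bar x p p).symm)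
        tr_phi := fun x => rfl
        tr_symm := fun t => symm t
        act_add := fun t x y => ext
          (by
            change σ.bar (x + y) * t.1.1 * (x + y) = σ.bar x * t.1.1 * x +
              (σ.bar y * t.1.1 * x + σ.bar (σ.bar y * t.1.1 * x) * σ.lam) +
              σ.bar y * t.1.1 * y
            rw [σ.bar_conj_mul_lam, ← symm t, _root_.map_add]
            noncomm_ring)
          (fun p => by
            change t.1.2 ((x + y) • p) = t.1.2 (x • p) + R.phi (B p ((σ.bar y * t.1.1 * x) • p)) +
              t.1.2 (y • p)
            -- The polarization of t gives B(p, bar x t y p), with x and y exchanged in comparison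
            -- with the axiom. Since t is symmetric, φ does not see the exchange.
            rw [add_smul, map_add, hB.smul_left, ← hB.phi_form_bar (σ.bar y * t.1.1 * x),
              σ.bar_conj_mul_lam, ← symm t, mul_assoc, mul_smul, mul_smul]) }
    smul_act := fun c t x => ext
      (by
        change _ • (σ.bar x * t.1.1 * x) = σ.bar x * (_ • t.1.1) * x
        rw [mul_smul_comm, smul_mul_assoc])
      (fun p => rfl)
    act_smul := fun c k t => ext
      (by
        change (QuadraticRing.qs (K := K) (AK := AK)).tr
          ((QuadraticRing.qs (K := K) (AK := AK)).act c k) • t.1.1 =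
          σ.bar (algebraMap K S k) * (_ • t.1.1) * algebraMap K S k
        rw [QuadraticRing.tr_act_eq, σ.bar_algebraMap, ← Algebra.smul_def, ← Algebra.commutes,
          ← Algebra.smul_def, smul_smul, smul_smul, mul_comm k, mul_assoc, mul_comm _ k,
          mul_assoc])
      (fun p => by
        change (QuadraticRing.qs (K := K) (AK := AK)).act c k • t.1.2 p =
          c • t.1.2 (algebraMap K S k • p)
        rw [central, map_smul, R.str.act_smul]
        exact (R.str.smul_act _ _ _).symm)
    smul_phi := fun c x => ext
      (by
        change _ • (x + σ.bar x * σ.lam) = _ • x + σ.bar (_ • x) * σ.lam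
        rw [QuadraticRing.bar_smul, QuadraticRing.star_tr, smul_add, smul_mul_assoc])
      (fun p => by
        change c • R.phi (B p (x • p)) = R.phi (B p ((_ • x) • p))
        rw [hB.form_algebra_smul central]
        exact R.str.smul_phi _ _)
    phi_smul := fun k t => ext
      (by
        change (QuadraticRing.qs (K := K) (AK := AK)).tr
          ((QuadraticRing.qs (K := K) (AK := AK)).phi k) • t.1.1 =
          k • t.1.1 + σ.bar (k • t.1.1) * σ.lam
        rw [QuadraticRing.tr_phi_eq, QuadraticRing.bar_smul, smul_mul_assoc, ← symm t, add_smul])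
      (fun p => by
        change (QuadraticRing.qs (K := K) (AK := AK)).phi k • t.1.2 p =
          R.phi (B p ((k • t.1.1) • p))
        rw [hB.form_algebra_smul central, ← tr_map]
        exact R.str.phi_smul _ _)
    tr_smul := fun c t => rfl }

/-- The evaluation of quadratic forms is a quadratic form on the bimodule `P`. -/
theorem isQuadraticForm : letI := module hB central
    IsQuadraticForm (str hB central) R.str B (fun t p => t.1.2 p) :=
  letI := module hB central
  { add_left := fun _ _ _ => rfl
    act_left := fun _ _ _ => rfl
    phi_left := fun _ _ => rfl
    smul_right := map_smul
    add_right := map_add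
    tr_apply := tr_map
    smul_left := fun _ _ _ => rfl }

end quadraticForms

end Universal

/-! ### Realizing quadratic forms by elements of the quadratic structure -/

section Realize

variable {K : Type v} {AK : Type w} [CommRing K] [StarRing K] [CommRing AK] [QuadraticRing K AK]
  {T S R : QuadAlg.{u} K AK}

namespace QuadBimod

/-- The quadratic algebra on `S` given by the quadratic forms on `P`. -/
def formAlg (P : QuadBimod S R) : QuadAlg.{u} K AK :=
  letI := quadraticForms.module P.herm P.central
  { carrier := S
    A := quadraticForms S.str.inv P.form
    str := quadraticForms.str P.herm P.central }

/-- `P` as a quadratic bimodule over the quadratic algebra given by the quadratic forms on `P`. -/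
def formBimod (P : QuadBimod S R) : QuadBimod P.formAlg R :=
  letI := quadraticForms.module P.herm P.central
  letI : Module P.formAlg P := inferInstanceAs (Module S P)
  haveI : SMulCommClass P.formAlg (R : Type u)ᵐᵒᵖ P :=
    inferInstanceAs (SMulCommClass S (R : Type u)ᵐᵒᵖ P)
  { carrier := P
    central := P.central
    form := P.form
    herm := P.herm
    q := fun t p => t.1.2 p
    quad := quadraticForms.isQuadraticForm P.herm P.central }

/-- The quadratic form on `P ⊗ Q` induced by a quadratic form on `P`. -/
def inducedForm {P : QuadBimod S R} (t : quadraticForms S.str.inv P.form) (Q : QuadBimod R T)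
    (x : P.tensor Q) : T.A :=
  (P.formBimod.tensor Q).q t x

theorem inducedForm_tmul {P : QuadBimod S R} (t : quadraticForms S.str.inv P.form)
    {Q : QuadBimod R T} (p : P) (q : Q) : inducedForm t Q (tmul p q) = Q.q (t.1.2 p) q := rfl

theorem inducedForm_add {P : QuadBimod S R} (t : quadraticForms S.str.inv P.form)
    {Q : QuadBimod R T} (x y : P.tensor Q) :
    inducedForm t Q (x + y) = inducedForm t Q x + inducedForm t Q y +
      T.phi ((P.tensor Q).form x (t.1.1 • y)) :=
  (P.formBimod.tensor Q).q_add_right t x y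

theorem tr_inducedForm {P : QuadBimod S R} (t : quadraticForms S.str.inv P.form)
    {Q : QuadBimod R T} (x : P.tensor Q) :
    T.tr (inducedForm t Q x) = (P.tensor Q).form x (t.1.1 • x) :=
  (P.formBimod.tensor Q).quad.tr_apply t x

/-- This extends `q_apply` to quadratic forms on P that are not yet known to come from an element of
S.A; the reason is again that ε is an isometry. -/
theorem q_inducedForm {P : QuadBimod S R} {Q : QuadBimod R S}
    (ε : Isometry (Q.tensor P) (one R)) (t : quadraticForms S.str.inv P.form) (x : P.tensor Q)
    (p : P) : P.q (inducedForm t Q x) p = t.1.2 (apply ε x p) := by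
  induction x using tmul_induction with
  | tmul p₁ q₁ =>
    rw [inducedForm_tmul, ← act_pair ε, apply_tmul, quadraticForms.map_smul]
  | add x y hx hy =>
    rw [inducedForm_add, P.quad.add_left, P.quad.add_left, hx, hy, map_add,
      AddMonoidHom.add_apply, quadraticForms.map_add, ← apply_smul_left, form_apply,
      add_right_comm]
    congr 2
    exact P.quad.phi_left _ _

/-- The element is the value at the copairing x of the form induced on P ⊗ Q. Its trace is B(x, s x)
= s, and its form on P is the given one because x acts as the identity. Together with
`quadratic_ext` this identifies S.A with the group of quadratic forms on P. -/
theorem Duality.exists_quadratic {P : QuadBimod S R} {Q : QuadBimod R S} (D : Duality P Q)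
    (t : quadraticForms S.str.inv P.form) :
    ∃ a : S.A, S.tr a = t.1.1 ∧ ∀ p, P.q a p = t.1.2 p :=
  ⟨inducedForm t Q D.copair,
    by rw [tr_inducedForm, D.form_copair],
    fun p => by rw [q_inducedForm D.counit, D.apply_copair]⟩

end QuadBimod

end Realize

/-! ### Comparison of quadratic structures along hermitian isomorphisms -/

section Comparison

variable {K : Type v} {AK : Type w} [CommRing K] [StarRing K] [CommRing AK] [QuadraticRing K AK]
  {S S' R : QuadAlg.{u} K AK}

namespace QuadBimod

/-- No nonzero element is right orthogonal to the whole bimodule. -/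
def RightSeparating (P : QuadBimod S R) : Prop :=
  ∀ x y : P, (∀ p, P.form p x = P.form p y) → x = y

/-- Isomorphisms of hermitian bimodules over isomorphisms of rings with pseudo-involution. -/
structure HermIso (P : QuadBimod S R) (P' : QuadBimod S' R) where
  equiv : P ≃+ P'
  alg : S ≃ₐ[K] S'
  map_smul_left : ∀ (s : S) (p : P), equiv (s • p) = alg s • equiv p
  map_smul_right : ∀ (r : R) (p : P), equiv (op r • p) = op r • equiv p
  form_map : ∀ p p' : P, P'.form (equiv p) (equiv p') = P.form p p'
  map_bar : ∀ s : S, alg (S.bar s) = S'.bar (alg s)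
  map_lam : alg S.lam = S'.lam

namespace HermIso

variable {P : QuadBimod S R} {P' : QuadBimod S' R}

/-- An isomorphism of bimodules preserving the forms is compatible with the pseudo-involutions. -/
def ofSeparating {Q' : QuadBimod R S'} (D' : Duality P' Q') (h : P'.RightSeparating)
    (equiv : P ≃+ P') (alg : S ≃ₐ[K] S')
    (map_smul_left : ∀ (s : S) (p : P), equiv (s • p) = alg s • equiv p)
    (map_smul_right : ∀ (r : R) (p : P), equiv (op r • p) = op r • equiv p)
    (form_map : ∀ p p' : P, P'.form (equiv p) (equiv p') = P.form p p') : HermIso P P' where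
  equiv := equiv
  alg := alg
  map_smul_left := map_smul_left
  map_smul_right := map_smul_right
  form_map := form_map
  -- The pseudo-involution and its symmetry can be read off from B, by B(p, bar s p') = B(s p, p')
  -- and B(p, λ p') = bar B(p', p) · λ. Equality in S' is then tested by its faithful action on P'
  -- and by right separation.
  map_bar s := D'.smul_ext fun p => h _ _ fun p' => by
    obtain ⟨p, rfl⟩ := equiv.surjective p
    obtain ⟨p', rfl⟩ := equiv.surjective p'
    rw [← map_smul_left, form_map, ← P.form_smul_left, ← P'.form_smul_left, ← map_smul_left,
      form_map]
  map_lam := D'.smul_ext fun p => h _ _ fun p' => by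
    obtain ⟨p, rfl⟩ := equiv.surjective p
    obtain ⟨p', rfl⟩ := equiv.surjective p'
    rw [← map_smul_left, form_map, P.form_symm, P'.form_symm, form_map]

/-- The inverse isomorphism. -/
def symm (c : HermIso P P') : HermIso P' P where
  equiv := c.equiv.symm
  alg := c.alg.symm
  map_smul_left s p := by
    rw [AddEquiv.symm_apply_eq, c.map_smul_left, AlgEquiv.apply_symm_apply,
      AddEquiv.apply_symm_apply]
  map_smul_right r p := by
    rw [AddEquiv.symm_apply_eq, c.map_smul_right, AddEquiv.apply_symm_apply]
  form_map p p' := by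
    rw [← c.form_map, AddEquiv.apply_symm_apply, AddEquiv.apply_symm_apply]
  map_bar s := by
    rw [AlgEquiv.symm_apply_eq, c.map_bar, AlgEquiv.apply_symm_apply]
  map_lam := by rw [AlgEquiv.symm_apply_eq, c.map_lam]

variable (c : HermIso P P')

/-- The quadratic form on `P'` corresponding to the quadratic form `q(a, -)` on `P`. -/
def transport (a : S.A) : quadraticForms S'.str.inv P'.form :=
  ⟨(c.alg (S.tr a), fun p => P.q a (c.symm.equiv p)), by
    refine ⟨?_, fun p r => ?_, fun p p' => ?_, fun p => ?_⟩
    · refine Eq.trans ?_ (congrArg₂ (· * ·) (c.map_bar (S.tr a)) c.map_lam)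
      rw [← map_mul]
      exact congrArg c.alg (S.str.qs.tr_symm a)
    · change P.q a (c.symm.equiv (op r • p)) = _
      rw [c.symm.map_smul_right, P.quad.smul_right]
    · change P.q a (c.symm.equiv (p + p')) = _
      rw [map_add, P.quad.add_right, ← c.symm.form_map, c.symm.map_smul_left]
      exact congrArg (fun s => P.q a _ + R.phi (P.form _ (s • _)) + _)
        (c.alg.symm_apply_apply (S.tr a)).symm
    · change R.tr (P.q a (c.symm.equiv p)) = _
      rw [← c.symm.form_map, c.symm.map_smul_left, QuadAlg.tr, P.quad.tr_apply]
      exact congrArg (fun s => P.form _ (s • _)) (c.alg.symm_apply_apply (S.tr a)).symm⟩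

variable {Q : QuadBimod R S} {Q' : QuadBimod R S'}

theorem exists_mapA (D' : Duality P' Q') (a : S.A) :
    ∃ a' : S'.A, S'.tr a' = c.alg (S.tr a) ∧ ∀ p, P'.q a' (c.equiv p) = P.q a p := by
  obtain ⟨a', h, h'⟩ := D'.exists_quadratic (c.transport a)
  exact ⟨a', h, fun p => (h' _).trans (congrArg (P.q a) (c.equiv.symm_apply_apply p))⟩

/-- The map of quadratic structures induced by an isomorphism of hermitian bimodules. -/
noncomputable def mapA (D' : Duality P' Q') (a : S.A) : S'.A := (c.exists_mapA D' a).choose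

theorem tr_mapA (D' : Duality P' Q') (a : S.A) : S'.tr (c.mapA D' a) = c.alg (S.tr a) :=
  (c.exists_mapA D' a).choose_spec.1

theorem q_mapA (D' : Duality P' Q') (a : S.A) (p : P) :
    P'.q (c.mapA D' a) (c.equiv p) = P.q a p :=
  (c.exists_mapA D' a).choose_spec.2 p

/-- Since trace and form determine an element of S'.A, every compatibility of `mapA` reduces to the
corresponding statement about traces and forms. -/
theorem eq_mapA (D' : Duality P' Q') (a : S.A) {a' : S'.A} (h : S'.tr a' = c.alg (S.tr a))
    (h' : ∀ p, P'.q a' (c.equiv p) = P.q a p) : a' = c.mapA D' a :=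
  D'.quadratic_ext (h.trans (c.tr_mapA D' a).symm) fun p => by
    obtain ⟨p, rfl⟩ := c.equiv.surjective p
    rw [h', q_mapA]

theorem mapA_symm_mapA (D : Duality P Q) (D' : Duality P' Q') (a : S.A) :
    c.symm.mapA D (c.mapA D' a) = a :=
  D.quadratic_ext
    (by rw [tr_mapA, tr_mapA]; exact c.alg.symm_apply_apply _)
    (fun p => by
      have h := c.symm.q_mapA D (c.mapA D' a) (c.equiv p)
      rw [c.q_mapA] at h
      rw [← h]
      exact congrArg _ (c.equiv.symm_apply_apply p).symm)

/-- The isomorphism of quadratic algebras induced by an isomorphism of hermitian bimodules. -/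
noncomputable def algIso (D : Duality P Q) (D' : Duality P' Q') : S.Iso S' where
  toAlgEquiv := c.alg
  mapA :=
    { toFun := c.mapA D'
      map_add' := fun a b => (c.eq_mapA D' _
        (by rw [map_add, map_add, map_add, tr_mapA, tr_mapA])
        (fun p => by rw [P'.quad.add_left, P.quad.add_left, q_mapA, q_mapA])).symm
      map_smul' := fun k a => (c.eq_mapA D' _
        (by
          refine (S'.str.tr_smul _ _).trans ((congrArg _ (c.tr_mapA D' a)).trans ?_)
          rw [← map_smul]
          exact congrArg c.alg (S.str.tr_smul k a).symm)
        (fun p => by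
          rw [RingHom.id_apply, P'.quad.smul_left, P.quad.smul_left, q_mapA])).symm
      invFun := c.symm.mapA D
      left_inv := c.mapA_symm_mapA D D'
      right_inv := c.symm.mapA_symm_mapA D' D }
  map_bar := c.map_bar
  map_lam := c.map_lam
  map_act a s := (c.eq_mapA D' _
    (by
      refine (S'.str.qs.tr_act _ _).trans (Eq.trans ?_ (congrArg c.alg (S.str.qs.tr_act a s).symm))
      rw [map_mul, map_mul]
      exact congrArg₂ (fun x y => x * y * c.alg s) (c.map_bar s).symm (c.tr_mapA D' a))
    (fun p => by
      refine (P'.quad.act_left _ _ _).trans (Eq.trans ?_ (P.quad.act_left _ _ _).symm)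
      rw [← c.map_smul_left]
      exact c.q_mapA D' a _)).symm
  map_phi s := (c.eq_mapA D' _
    (by
      refine (S'.str.qs.tr_phi _).trans (Eq.trans ?_ (congrArg c.alg (S.str.qs.tr_phi s).symm))
      rw [map_add, map_mul]
      exact congrArg₂ (fun x y => c.alg s + x * y) (c.map_bar s).symm c.map_lam.symm)
    (fun p => by
      refine (P'.quad.phi_left _ _).trans (Eq.trans ?_ (P.quad.phi_left _ _).symm)
      rw [← c.map_smul_left, c.form_map])).symm
  map_tr a := (c.tr_mapA D' a).symm

theorem algIso_unique (D : Duality P Q) (D' : Duality P' Q') {e : S.Iso S'}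
    (h : ∀ s, e.toAlgEquiv s = c.alg s) (h' : ∀ a p, P'.q (e.mapA a) (c.equiv p) = P.q a p) :
    e = c.algIso D D' :=
  QuadAlg.Iso.ext (AlgEquiv.ext h)
    (LinearEquiv.ext fun a => c.eq_mapA D' a ((e.map_tr a).symm.trans (h _)) (h' a))

end HermIso

end QuadBimod

end Comparison

/-! ### Full bimodules: Morita arguments and isomorphisms of adjunctions -/

section Full

variable {K : Type v} {AK : Type w} [CommRing K] [StarRing K] [CommRing AK] [QuadraticRing K AK]
  {S S' R : QuadAlg.{u} K AK}

namespace QuadBimod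

/-- A bimodule is full if all its right linear endomorphisms are given by left multiplications. -/
def Full (P : QuadBimod S R) : Prop :=
  ∀ f : P →ₗ[(R : Type u)ᵐᵒᵖ] P, ∃ s : S, ∀ p, f p = s • p

theorem isIso_of_bijective {M N : QuadBimod S R} (f : M ⟶ N)
    (h : Function.Bijective (Isometry.hom f)) : IsIso f :=
  (mkIso f (Equiv.ofBijective _ h).symm (Equiv.ofBijective _ h).symm_apply_apply
    (Equiv.ofBijective _ h).apply_symm_apply).isIso_hom

theorem surjective_of_isIso {M N : QuadBimod S R} (f : M ⟶ N) [IsIso f] :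
    Function.Surjective (Isometry.hom f) := fun n =>
  ⟨(inv f).hom n, by rw [← comp_hom_apply, IsIso.inv_hom_id, id_hom_apply]⟩

namespace Duality

variable {P : QuadBimod S R} {Q : QuadBimod R S} (D : Duality P Q)

/-- Applying f to the first factor of the copairing gives an element of P ⊗ Q that acts on P as f.
If it is the unit's image of s, it acts as s. -/
theorem full_of_surjective (D : Duality P Q) (h : Function.Surjective D.unit.hom) :
    P.Full := fun f => by
  obtain ⟨s, hs⟩ := h (mapLeft f Q D.copair)
  refine ⟨s, fun p => ?_⟩
  rw [← D.apply_unit_of s p]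
  refine Eq.trans ?_ (congrArg (fun x => apply D.counit x p) hs.symm)
  rw [apply_mapLeft, D.apply_copair]

/-- By the triangle identity for Q, p ⊗ q is its own product with the copairing. Fullness replaces
the left factor of this product by an element of S. -/
theorem exists_eq_smul_copair (hP : P.Full) (x : P.tensor Q) : ∃ s : S, x = s • D.copair := by
  induction x using tmul_induction with
  | tmul p q =>
    obtain ⟨s, hs⟩ := hP (applyLinear D.counit (tmul p q))
    refine ⟨s, ?_⟩
    rw [← tmul_contract_pairLinear D.counit p q D.copair s fun p' => (hs p').symm,
      D.contract_copair]
  | add x y hx hy =>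
    obtain ⟨s, rfl⟩ := hx
    obtain ⟨s', rfl⟩ := hy
    exact ⟨s + s', (add_smul _ _ _).symm⟩

theorem apply_ext (hP : P.Full) {x y : P.tensor Q}
    (h : ∀ p, apply D.counit x p = apply D.counit y p) : x = y := by
  obtain ⟨s, rfl⟩ := D.exists_eq_smul_copair hP x
  obtain ⟨s', rfl⟩ := D.exists_eq_smul_copair hP y
  have e : s = s' := D.smul_ext fun p => by
    simpa only [apply_smul_left, D.apply_copair] using h p
  rw [e]

theorem unit_bijective (hP : P.Full) : Function.Bijective D.unit.hom := by
  refine ⟨fun s s' h => D.smul_ext fun p => ?_, fun x => ?_⟩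
  · exact (D.apply_unit_of (one.val s) p).symm.trans
      ((congrArg (fun x => apply D.counit x p) h).trans (D.apply_unit_of (one.val s') p))
  · obtain ⟨s, rfl⟩ := D.exists_eq_smul_copair hP x
    exact ⟨one.of s, D.unit_of s⟩

/-- This is the associativity of the Morita context formed by P, Q, ε and the map from P ⊗ Q to the
endomorphisms of P. -/
theorem counit_smul_comm (hP : P.Full) (x y : Q.tensor P) :
    op (one.val (D.counit.hom y)) • x = one.val (D.counit.hom x) • y := by
  have key : ∀ (q q' : Q) (p p' : P), op (pair D.counit q' p') • (tmul q p : Q.tensor P) =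
      pair D.counit q p • tmul q' p' := fun q q' p p' => by
    -- With s acting on P as p ⊗ q', one has ε(q ⊗ p) q' = q s, and s can then be moved across the
    -- tensor sign.
    obtain ⟨s, hs⟩ := hP (applyLinear D.counit (tmul p q'))
    have e : pair D.counit q p • q' = op s • q := D.pair_ext fun p'' => by
      rw [pair_smul_left, pair_op_smul, ← hs]
      exact (pair_smul_right _ _ _ _).symm
    rw [left_smul_tmul, e, smul_tmul, ← hs]
    rfl
  induction x using tmul_induction with
  | add x x' hx hx' =>
    rw [smul_add, hx, hx', map_add]
    exact (add_smul (one.val (D.counit.hom x)) (one.val (D.counit.hom x')) y).symm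
  | tmul q p =>
    induction y using tmul_induction with
    | add y y' hy hy' =>
      rw [smul_add, ← hy, ← hy', map_add]
      exact add_smul (op (one.val (D.counit.hom y))) (op (one.val (D.counit.hom y'))) (tmul q p)
    | tmul q' p' => exact key q q' p p'

/-- If ε(z) = 1, then y = y ε(z) = ε(y) z for all y, so ε is injective; it is surjective because its
image is closed under multiplication from the left. -/
theorem counit_bijective (hP : P.Full) (h : ∃ x, D.counit.hom x = one.of 1) :
    Function.Bijective D.counit.hom := by
  obtain ⟨z, hz⟩ := h
  refine ⟨(injective_iff_map_eq_zero _).2 fun x hx => ?_, fun r => ?_⟩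
  · have e := D.counit_smul_comm hP x z
    rw [hz, hx] at e
    exact (one_smul (R : Type u)ᵐᵒᵖ x).symm.trans (e.trans (zero_smul (R : Type u) z))
  · refine ⟨one.val r • z, ?_⟩
    rw [D.counit.map_smul_left, hz]
    exact mul_one (one.val r)

end Duality

namespace HermIso

variable {P : QuadBimod S R} {Q : QuadBimod R S} {P' : QuadBimod S' R} {Q' : QuadBimod R S'}

theorem exists_alg (hP : P'.Full) (e : P ≃+ P')
    (he : ∀ (r : R) (p : P), e (op r • p) = op r • e p) (s : S) :
    ∃ s' : S', ∀ p, e (s • p) = s' • e p := by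
  have he' : ∀ (r : (R : Type u)ᵐᵒᵖ) (p : P'), e.symm (r • p) = r • e.symm p := fun r p => by
    rw [AddEquiv.symm_apply_eq]
    exact ((he r.unop _).trans (congrArg (r • ·) (e.apply_symm_apply p))).symm
  obtain ⟨s', h⟩ := hP
    { toFun := fun p => e (s • e.symm p)
      map_add' := fun p p' => by rw [map_add, smul_add, map_add]
      map_smul' := fun r p => by
        rw [he', smul_comm]
        exact he r.unop _ }
  refine ⟨s', fun p => (Eq.trans ?_ (h (e p)))⟩
  exact congrArg (fun p => e (s • p)) (e.symm_apply_apply p).symm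

/-- The isomorphism of rings determined by an isomorphism of full bimodules. -/
noncomputable def algOfFull (D : Duality P Q) (D' : Duality P' Q') (hP : P.Full) (hP' : P'.Full)
    (e : P ≃+ P') (he : ∀ (r : R) (p : P), e (op r • p) = op r • e p) : S ≃ₐ[K] S' :=
  have h := fun s => (exists_alg hP' e he s).choose_spec
  have ext : ∀ {s s' : S'}, (∀ p : P, s • e p = s' • e p) → s = s' := fun h =>
    D'.smul_ext fun p => by
    obtain ⟨p, rfl⟩ := e.surjective p
    exact h p
  AlgEquiv.ofBijective
    { toFun := fun s => (exists_alg hP' e he s).choose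
      map_one' := ext fun p => by rw [← h, one_smul, one_smul]
      map_mul' := fun s s' => ext fun p => by rw [mul_smul, ← h, ← h, ← h, mul_smul]
      map_zero' := ext fun p => by rw [← h, zero_smul, zero_smul, map_zero]
      map_add' := fun s s' => ext fun p => by rw [add_smul, ← h, ← h, ← h, add_smul, map_add]
      commutes' := fun k => ext fun p => by rw [← h, P.central, P'.central, he] }
    (by
      refine ⟨fun s s' hs => D.smul_ext fun p => e.injective ?_, fun s' => ?_⟩
      · rw [h, h]
        exact congrArg (· • e p) hs
      · have he' : ∀ (r : R) (p : P'), e.symm (op r • p) = op r • e.symm p := fun r p => by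
          rw [AddEquiv.symm_apply_eq, he, AddEquiv.apply_symm_apply]
        obtain ⟨s, hs⟩ := exists_alg hP e.symm he' s'
        refine ⟨s, ext fun p => ?_⟩
        refine (h s p).symm.trans ?_
        rw [← e.eq_symm_apply, hs, AddEquiv.symm_apply_apply])

theorem algOfFull_smul (D : Duality P Q) (D' : Duality P' Q') (hP : P.Full) (hP' : P'.Full)
    (e : P ≃+ P') (he : ∀ (r : R) (p : P), e (op r • p) = op r • e p) (s : S) (p : P) :
    e (s • p) = algOfFull D D' hP hP' e he s • e p :=
  (exists_alg hP' e he s).choose_spec p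

variable (c : HermIso P P') (D : Duality P Q) (D' : Duality P' Q')

/-- The right linear form on `P'` given by an element of `Q`. -/
def pairSymm (q : Q) : P' →ₗ[(R : Type u)ᵐᵒᵖ] R where
  toFun p := pair D.counit q (c.equiv.symm p)
  map_add' p p' := by rw [map_add, map_add]
  map_smul' r p := by
    have h : c.equiv.symm (r • p) = op r.unop • c.equiv.symm p := c.symm.map_smul_right r.unop p
    rw [h, pair_smul_right]
    rfl

/-- The map `Q → Q'` adjoint to the isomorphism `P ≅ P'`. -/
def dual (q : Q) : Q' := contract (c.pairSymm D q) Q' D'.copair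

theorem pair_dual (q : Q) (p : P) :
    pair D'.counit (c.dual D D' q) (c.equiv p) = pair D.counit q p := by
  rw [dual, pair_contract, D'.apply_copair]
  exact congrArg (pair D.counit q) (c.equiv.symm_apply_apply p)

theorem eq_dual {q : Q} {q' : Q'}
    (h : ∀ p, pair D'.counit q' (c.equiv p) = pair D.counit q p) : q' = c.dual D D' q :=
  D'.pair_ext fun p => by
    obtain ⟨p, rfl⟩ := c.equiv.surjective p
    rw [h, pair_dual]

theorem dual_symm_dual (q : Q) : c.symm.dual D' D (c.dual D D' q) = q :=
  (c.symm.eq_dual D' D fun p => by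
    obtain ⟨p, rfl⟩ := c.equiv.surjective p
    rw [c.pair_dual]
    exact congrArg _ (c.equiv.symm_apply_apply p)).symm

/-- The isometry condition on the counits gives B(p, B(q, q') p') = bar ε(q ⊗ p) · ε(q' ⊗ p'). With
right separation and the faithful action this determines the form on the left adjoint by the
pairing, which `dual` preserves. -/
theorem form_dual (h : P'.RightSeparating) (q q' : Q) :
    Q'.form (c.dual D D' q) (c.dual D D' q') = c.alg (Q.form q q') :=
  D'.smul_ext fun p => h _ _ fun p' => by
    obtain ⟨p, rfl⟩ := c.equiv.surjective p
    obtain ⟨p', rfl⟩ := c.equiv.surjective p'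
    rw [← bar_pair_mul_pair, pair_dual, pair_dual, bar_pair_mul_pair, ← c.map_smul_left,
      c.form_map]

theorem dual_smul_left (r : R) (q : Q) : c.dual D D' (r • q) = r • c.dual D D' q :=
  (c.eq_dual D D' fun p => by
    rw [pair_smul_left, pair_smul_left, c.pair_dual]).symm

theorem dual_smul_right (s : S) (q : Q) :
    c.dual D D' (op s • q) = op (c.alg s) • c.dual D D' q :=
  (c.eq_dual D D' fun p => by
    rw [pair_op_smul, pair_op_smul, ← c.map_smul_left, c.pair_dual]).symm

theorem dual_add (q q' : Q) : c.dual D D' (q + q') = c.dual D D' q + c.dual D D' q' :=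
  (c.eq_dual D D' fun p => by
    rw [map_add, AddMonoidHom.add_apply, map_add, AddMonoidHom.add_apply, c.pair_dual,
      c.pair_dual]).symm

/-- As for the form: q(a, q₁) has trace B(q₁, tr a q₁), and as a quadratic form on P it is p ↦ a ·
ε(q₁ ⊗ p). Both are preserved by `dual`. -/
theorem q_dual (h : P'.RightSeparating) (a : R.A) (q : Q) :
    Q'.q a (c.dual D D' q) = c.mapA D' (Q.q a q) :=
  c.eq_mapA D' _
    (by
      refine (Q'.quad.tr_apply _ _).trans (Eq.trans ?_ (congrArg c.alg (Q.quad.tr_apply a q).symm))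
      rw [← c.form_dual D D' h, c.dual_smul_left])
    (fun p => by rw [← act_pair D.counit, ← act_pair D'.counit, c.pair_dual])

/-- `dual` as an isomorphism of quadratic bimodules. -/
noncomputable def dualIso (h : P'.RightSeparating) :
    SemiIso (QuadAlg.Iso.refl R) (c.algIso D D') Q Q' where
  equiv :=
    { toFun := c.dual D D'
      invFun := c.symm.dual D' D
      left_inv := c.dual_symm_dual D D'
      right_inv := c.symm.dual_symm_dual D' D
      map_add' := c.dual_add D D' }
  map_smul_left := c.dual_smul_left D D'
  map_smul_right := c.dual_smul_right D D'
  form_map := c.form_dual D D' h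
  q_map := c.q_dual D D' h

/-- The given isomorphism as an isomorphism of quadratic bimodules. -/
noncomputable def rightIso : SemiIso (c.algIso D D') (QuadAlg.Iso.refl R) P P' where
  equiv := c.equiv
  map_smul_left := c.map_smul_left
  map_smul_right := c.map_smul_right
  form_map := c.form_map
  q_map := c.q_mapA D'

/-- For a full P', elements of P' ⊗ Q' are determined by their action on P', so this intertwining
reduces compatibility with the units to the actions of the rings. -/
theorem apply_tensorMap (h : P'.RightSeparating) (x : P.tensor Q) (p : P) :
    apply D'.counit ((c.rightIso D D').tensorMap (c.dualIso D D' h) x) (c.equiv p) =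
      c.equiv (apply D.counit x p) := by
  induction x using tmul_induction with
  | tmul p' q =>
    refine (apply_tmul _ _ _ _).trans ((congrArg (fun r => op r • c.equiv p')
      (c.pair_dual D D' q p)).trans ?_)
    rw [apply_tmul, c.map_smul_right]
  | add x y hx hy => simp only [map_add, AddMonoidHom.add_apply, hx, hy]

theorem counit_tensorMap (h : P'.RightSeparating) (x : Q.tensor P) :
    D'.counit.hom ((c.dualIso D D' h).tensorMap (c.rightIso D D') x) = D.counit.hom x := by
  induction x using tmul_induction with
  | tmul q p => exact c.pair_dual D D' q p
  | add x y hx hy => rw [map_add, map_add, hx, hy, map_add]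

end HermIso

section AdjunctionIso

variable {P : QuadBimod S R} {Q : QuadBimod R S} {P' : QuadBimod S' R} {Q' : QuadBimod R S'}
  (adj : Bicategory.Adjunction (B := QuadAlg.{u} K AK) (a := S) (b := R) Q P)
  (adj' : Bicategory.Adjunction (B := QuadAlg.{u} K AK) (a := S') (b := R) Q' P')

/-- The isomorphism of adjunctions induced by an isomorphism of hermitian bimodules. -/
noncomputable def HermIso.adjunctionIso (c : HermIso P P') (h : P'.RightSeparating)
    (hP' : P'.Full) : AdjunctionIso adj adj' where
  base := c.algIso (.ofAdjunction adj) (.ofAdjunction adj')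
  right := c.rightIso (.ofAdjunction adj) (.ofAdjunction adj')
  left := c.dualIso (.ofAdjunction adj) (.ofAdjunction adj') h
  unit_comm s := (Duality.ofAdjunction adj').apply_ext hP' fun p => by
    obtain ⟨p, rfl⟩ := c.equiv.surjective p
    refine (c.apply_tensorMap (.ofAdjunction adj) (.ofAdjunction adj') h _ p).trans ?_
    refine (congrArg c.equiv ((Duality.ofAdjunction adj).apply_unit_of s p)).trans ?_
    exact (c.map_smul_left s p).trans
      ((Duality.ofAdjunction adj').apply_unit_of (c.alg s) (c.equiv p)).symm
  counit_comm := c.counit_tensorMap (.ofAdjunction adj) (.ofAdjunction adj') h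

/-- Uniqueness goes through the components in the order of their dependence: the map on P fixes the
ring map by faithfulness, then traces and forms fix the map of quadratic structures, and
compatibility with the counits fixes the map on Q because an element of Q' is determined by its
pairing with P'. -/
theorem existsUnique_adjunctionIso (c : HermIso P P') (h : P'.RightSeparating)
    (hP' : P'.Full) : ∃! Φ : AdjunctionIso adj adj', ∀ p : P, Φ.right.equiv p = c.equiv p := by
  refine ⟨c.adjunctionIso adj adj' h hP', fun p => rfl, fun Φ hΦ => ?_⟩
  obtain ⟨base, right, left, unit_comm, counit_comm⟩ := Φ
  have hb : base = c.algIso (.ofAdjunction adj) (.ofAdjunction adj') := by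
    refine c.algIso_unique _ _ (fun s => ?_) (fun a p => ?_)
    · refine (Duality.ofAdjunction adj').smul_ext fun p => ?_
      obtain ⟨p, rfl⟩ := c.equiv.surjective p
      rw [← c.map_smul_left]
      have e := right.map_smul_left s p
      exact (congrArg _ (hΦ p).symm).trans (e.symm.trans (hΦ _))
    · exact (congrArg _ (hΦ p).symm).trans (right.q_map a p)
  subst hb
  have hr : right = c.rightIso (.ofAdjunction adj) (.ofAdjunction adj') :=
    SemiIso.ext (AddEquiv.ext hΦ)
  subst hr
  have hl : left = c.dualIso (.ofAdjunction adj) (.ofAdjunction adj') h :=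
    SemiIso.ext (AddEquiv.ext fun q =>
      c.eq_dual (.ofAdjunction adj) (.ofAdjunction adj') fun p => counit_comm (tmul q p))
  subst hl
  rfl

end AdjunctionIso

end QuadBimod

end Full

/-! ### Dual bases -/

section DualBasis

variable {R P : Type*} [Ring R] [AddCommGroup P] [Module Rᵐᵒᵖ P]

theorem finite_and_projective_of_dual_basis {n : ℕ} (x : Fin n → P)
    (f : Fin n → P →ₗ[Rᵐᵒᵖ] R) (h : ∀ p, ∑ i, op (f i p) • x i = p) :
    Module.Finite Rᵐᵒᵖ P ∧ Module.Projective Rᵐᵒᵖ P := by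
  let g : (Fin n → Rᵐᵒᵖ) →ₗ[Rᵐᵒᵖ] P := Fintype.linearCombination Rᵐᵒᵖ x
  let k : P →ₗ[Rᵐᵒᵖ] (Fin n → Rᵐᵒᵖ) :=
    { toFun := fun p i => op (f i p)
      map_add' := fun p p' => by ext i; simp
      map_smul' := fun r p => by
        ext i
        change op (f i (r • p)) = r * op (f i p)
        rw [map_smul]; rfl }
  have e : g ∘ₗ k = LinearMap.id := LinearMap.ext h
  exact ⟨Module.Finite.of_surjective g fun p => ⟨k p, h p⟩, Module.Projective.of_split k g e⟩

theorem exists_dual_basis (R P : Type*) [Ring R] [AddCommGroup P] [Module Rᵐᵒᵖ P]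
    [Module.Finite Rᵐᵒᵖ P] [Module.Projective Rᵐᵒᵖ P] :
    ∃ (n : ℕ) (x : Fin n → P) (f : Fin n → P →ₗ[Rᵐᵒᵖ] R), ∀ p, ∑ i, op (f i p) • x i = p := by
  obtain ⟨n, g, k, -, -, h⟩ := Module.Finite.exists_comp_eq_id_of_projective Rᵐᵒᵖ P
  refine ⟨n, fun i => g (Pi.single i 1), fun i =>
    { toFun := fun p => unop (k p i)
      map_add' := fun p p' => by simp
      map_smul' := fun r p => by simp }, fun p => ?_⟩
  conv_rhs => rw [← LinearMap.id_apply (R := Rᵐᵒᵖ) p, ← h, LinearMap.comp_apply]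
  conv_rhs => rw [← Finset.univ_sum_single (k p), map_sum]
  refine Finset.sum_congr rfl fun i _ => ?_
  rw [← map_smul, ← Pi.single_smul, smul_eq_mul, mul_one]
  rfl

variable {K : Type*} [CommRing K] [StarRing K] [Algebra K R] {σ : PseudoInvolution K R}
  {B : P →+ P →+ R}

/-- The coordinate forms of any dual basis are of the shape B(yᵢ, -) by nondegeneracy. -/
theorem IsNondegenerate.exists_dual_basis (h : IsNondegenerate σ B) :
    ∃ (n : ℕ) (x y : Fin n → P), ∀ p, ∑ i, op (B (y i) p) • x i = p := by
  have := h.finite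
  have := h.projective
  obtain ⟨n, x, f, hf⟩ := _root_.exists_dual_basis R P
  choose y hy using fun i => h.bijective.2 (f i)
  exact ⟨n, x, y, fun p => (Finset.sum_congr rfl fun i _ => by rw [← hy i]; rfl).trans (hf p)⟩

/-- Nondegeneracy only speaks of p ↦ B(p, -). Separation in the other variable follows from p = ∑ xᵢ
B(yᵢ, p). -/
theorem IsNondegenerate.right_separating (h : IsNondegenerate σ B) {p p' : P}
    (hp : ∀ x, B x p = B x p') : p = p' := by
  obtain ⟨n, x, y, hxy⟩ := h.exists_dual_basis
  rw [← hxy p, ← hxy p']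
  simp only [hp]

end DualBasis

/-! ### Full projectivity and nondegeneracy from the unit and counit -/

section Equivalence

variable {K : Type v} {AK : Type w} [CommRing K] [StarRing K] [CommRing AK] [QuadraticRing K AK]
  {T S R : QuadAlg.{u} K AK}

namespace QuadBimod

theorem exists_sum_tmul {L : QuadBimod T S} {M : QuadBimod S R} (x : L.tensor M) :
    ∃ (n : ℕ) (l : Fin n → L) (m : Fin n → M), x = ∑ i, tmul (l i) (m i) := by
  induction x using tmul_induction with
  | tmul l m => exact ⟨1, fun _ => l, fun _ => m, by simp⟩
  | add x y hx hy =>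
    obtain ⟨n, l, m, rfl⟩ := hx
    obtain ⟨n', l', m', rfl⟩ := hy
    exact ⟨n + n', Fin.append l l', Fin.append m m', by simp [Fin.sum_univ_add]⟩

namespace Duality

variable {P : QuadBimod S R} {Q : QuadBimod R S} (D : Duality P Q)

/-- If the copairing is ∑ pᵢ ⊗ qᵢ, then the pᵢ and the forms ε(qᵢ ⊗ -) are a dual basis of P. -/
theorem finite_and_projective (D : Duality P Q) :
    Module.Finite (R : Type u)ᵐᵒᵖ P ∧ Module.Projective (R : Type u)ᵐᵒᵖ P := by
  obtain ⟨n, p, q, h⟩ := exists_sum_tmul D.copair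
  refine finite_and_projective_of_dual_basis p (fun i => pairLinear D.counit (q i)) fun x => ?_
  conv_rhs => rw [← D.apply_copair x, h, map_sum, AddMonoidHom.finsetSum_apply]
  rfl

theorem exists_sum_pair (h : Function.Surjective D.counit.hom) :
    ∃ (n : ℕ) (q : Fin n → Q) (p : Fin n → P), ∑ i, pair D.counit (q i) (p i) = 1 := by
  obtain ⟨x, hx⟩ := h (one.of 1)
  obtain ⟨n, q, p, rfl⟩ := exists_sum_tmul x
  exact ⟨n, q, p, (map_sum D.counit.hom _ _).symm.trans hx⟩

/-- Write 1 = ∑ ε(qᵢ ⊗ pᵢ). The map r ↦ (pᵢ r) into a power of P is split by the sum of the forms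
ε(qᵢ ⊗ -). -/
theorem isFullyProjective (h : Function.Surjective D.counit.hom) : IsFullyProjective R P := by
  obtain ⟨n, q, p, hqp⟩ := D.exists_sum_pair h
  refine ⟨D.finite_and_projective.1, D.finite_and_projective.2, n,
    { toFun := fun r i => op r • p i
      map_add' := fun r r' => by
        ext i
        exact add_smul (op r) (op r') (p i)
      map_smul' := fun r r' => by
        ext i
        exact mul_smul r (op r') (p i) },
    ∑ i, (pairLinear D.counit (q i)).comp (LinearMap.proj i), LinearMap.ext fun r => ?_⟩
  rw [LinearMap.comp_apply, LinearMap.sum_apply]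
  refine Eq.trans ?_ ((congrArg (· * r) hqp).trans (one_mul r))
  rw [Finset.sum_mul]
  exact Finset.sum_congr rfl fun i _ => pair_smul_right D.counit r (q i) (p i)

/-- The isometry condition bar ε(q ⊗ p) · ε(q' ⊗ p') = B(p, B(q, q') p') converts values of ε into
values of B, once 1 is a sum of values of ε. -/
theorem isNondegenerate (h : Function.Surjective D.counit.hom) :
    IsNondegenerate R.str.inv P.form where
  finite := D.finite_and_projective.1
  projective := D.finite_and_projective.2
  sesquilinear := P.herm.sesquilinear
  bijective := by
    obtain ⟨n, u, v, huv⟩ := D.exists_sum_pair h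
    refine ⟨fun p p' hp => ?_, fun f => ?_⟩
    · have hp : ∀ x, P.form p x = P.form p' x := fun x => DFunLike.congr_fun hp x
      -- Multiplying by 1 = ∑ ε(uᵢ ⊗ vᵢ) expresses bar ε(q ⊗ p) as ∑ B(p, B(q, uᵢ) vᵢ), which only
      -- depends on B(p, -).
      have e : ∀ q, R.bar (pair D.counit q p) = R.bar (pair D.counit q p') := fun q => by
        rw [← mul_one (R.bar _), ← huv, Finset.mul_sum, ← mul_one (R.bar (pair D.counit q p')),
          ← huv, Finset.mul_sum]
        simp only [bar_pair_mul_pair, hp]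
      rw [← D.apply_copair p, ← D.apply_copair p']
      obtain ⟨m, a, b, hab⟩ := exists_sum_tmul D.copair
      rw [hab, map_sum, AddMonoidHom.finsetSum_apply, AddMonoidHom.finsetSum_apply]
      refine Finset.sum_congr rfl fun i _ => ?_
      rw [apply_tmul, apply_tmul, R.str.inv.bar_injective (e (b i))]
    -- The form f is ε(g ⊗ -), where g is the contraction of f with the copairing. Since 1 = ∑ bar
    -- ε(uᵢ ⊗ vᵢ), f(p) is the sum of the B(vᵢ, B(uᵢ, g) p). Moving B(uᵢ, g) to the first argument
    -- takes the inverse of bar on S.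
    · refine ⟨∑ i, S.str.inv.barInv (Q.form (u i) (contract f Q D.copair)) • v i,
        LinearMap.ext fun p => ?_⟩
      change P.form _ p = f p
      rw [map_sum, AddMonoidHom.finsetSum_apply]
      have e : ∀ i, P.form (S.str.inv.barInv (Q.form (u i) (contract f Q D.copair)) • v i) p =
          R.bar (pair D.counit (u i) (v i)) * f p := fun i => by
        rw [P.form_smul_left, QuadAlg.bar, PseudoInvolution.bar_barInv,
          ← bar_pair_mul_pair D.counit, pair_contract, D.apply_copair]
      simp only [e]
      rw [← Finset.sum_mul, ← map_sum, huv, QuadAlg.bar, R.str.inv.bar_one, one_mul]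

end Duality

end QuadBimod

end Equivalence

/-! ### Adjoint endomorphisms and the symmetry of a nondegenerate form -/

section Sesquilinear

variable {K R P : Type*} [CommRing K] [StarRing K] [Ring R] [Algebra K R]
  {σ : PseudoInvolution K R} [AddCommGroup P] [Module Rᵐᵒᵖ P] {B : P →+ P →+ R}

theorem IsSesquilinear.smul_right (h : IsSesquilinear σ B) (p p' : P) (r : R) :
    B p (op r • p') = B p p' * r := by
  simpa [σ.bar_one] using h p p' 1 r

theorem IsSesquilinear.op_smul (h : IsSesquilinear σ B) (p p' : P) (r : R) :
    B (op r • p) p' = σ.bar r * B p p' := by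
  simpa using h p p' r 1

namespace IsNondegenerate

variable (h : IsNondegenerate σ B)

theorem left_separating (h : IsNondegenerate σ B) {p p' : P} (hp : ∀ x, B p x = B p' x) : p = p' :=
  h.bijective.1 (LinearMap.ext hp)

/-- Every antilinear form is `B(-, w)` for some `w`. -/
theorem exists_form_eq (h : IsNondegenerate σ B) (g : P →+ R)
    (hg : ∀ (p : P) (r : R), g (op r • p) = σ.bar r * g p) : ∃ w, ∀ p, B p w = g p := by
  obtain ⟨n, x, y, hxy⟩ := h.exists_dual_basis
  -- The yᵢ also generate P: the coefficients are chosen so that B(-, p') takes the value ∑ B(p, xᵢ)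
  -- B(yᵢ, p') = B(p, p') on the sum. Evaluating an antilinear g on this expansion yields w = ∑ xᵢ
  -- g(yᵢ).
  have e : ∀ p, ∑ i, op (σ.barInv (B p (x i))) • y i = p := fun p =>
    h.left_separating fun p' => by
      rw [map_sum, AddMonoidHom.finsetSum_apply]
      conv_rhs => rw [← hxy p', map_sum]
      refine Finset.sum_congr rfl fun i _ => ?_
      rw [h.sesquilinear.op_smul, h.sesquilinear.smul_right, σ.bar_barInv]
  refine ⟨∑ i, op (g (y i)) • x i, fun p => ?_⟩
  conv_rhs => rw [← e p]
  rw [map_sum, map_sum]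
  refine Finset.sum_congr rfl fun i _ => ?_
  rw [hg, h.sesquilinear.smul_right, σ.bar_barInv]

theorem exists_adjoint (h : IsNondegenerate σ B) (s : Module.End Rᵐᵒᵖ P) :
    ∃ s' : Module.End Rᵐᵒᵖ P, ∀ p p', B (s p) p' = B p (s' p') := by
  have e : ∀ p', ∃ w, ∀ p, B p w = B (s p) p' := fun p' =>
    h.exists_form_eq (AddMonoidHom.mk' (fun p => B (s p) p') fun x y => by simp)
      fun p r => by
        change B (s (op r • p)) p' = _
        rw [map_smul, h.sesquilinear.op_smul]; rfl
  choose f hf using e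
  exact ⟨
    { toFun := f
      map_add' := fun x y => h.right_separating fun p => by
        rw [hf, map_add, map_add, hf, hf]
      map_smul' := fun r x => h.right_separating fun p => by
        rw [hf, RingHom.id_apply, ← op_unop r, h.sesquilinear.smul_right,
          h.sesquilinear.smul_right, hf] }, fun p p' => (hf p' p).symm⟩

/-- The adjoint of an endomorphism. -/
noncomputable def adjoint (s : Module.End Rᵐᵒᵖ P) : Module.End Rᵐᵒᵖ P :=
  (h.exists_adjoint s).choose

theorem form_adjoint (s : Module.End Rᵐᵒᵖ P) (p p' : P) : B p (h.adjoint s p') = B (s p) p' :=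
  ((h.exists_adjoint s).choose_spec p p').symm

theorem end_ext (h : IsNondegenerate σ B) {s s' : Module.End Rᵐᵒᵖ P}
    (hs : ∀ p p', B p (s p') = B p (s' p')) : s = s' :=
  LinearMap.ext fun p' => h.right_separating fun p => hs p p'

/-- For fixed p' the right side is antilinear in p, so it is B(-, w) for a unique w, and l sends p'
to w. The inverse of l is its adjoint. -/
theorem exists_symmetry (h : IsNondegenerate σ B) :
    ∃ l : (Module.End Rᵐᵒᵖ P)ˣ, ∀ p p', B p (l.1 p') = σ.bar (B p' p) * σ.lam := by
  have e : ∀ p', ∃ w, ∀ p, B p w = σ.bar (B p' p) * σ.lam := fun p' =>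
    h.exists_form_eq (AddMonoidHom.mk' (fun p => σ.bar (B p' p) * σ.lam)
        fun x y => by simp [add_mul])
      fun p r => by
        change σ.bar (B p' (op r • p)) * σ.lam = _
        rw [h.sesquilinear.smul_right, σ.bar_mul, mul_assoc]; rfl
  choose f hf using e
  let l : Module.End Rᵐᵒᵖ P :=
    { toFun := f
      map_add' := fun x y => h.right_separating fun p => by
        rw [hf, map_add, AddMonoidHom.add_apply, map_add, map_add, hf, hf, add_mul]
      map_smul' := fun r x => h.right_separating fun p => by
        rw [hf, RingHom.id_apply, ← op_unop r, h.sesquilinear.smul_right,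
          h.sesquilinear.op_smul, hf, σ.bar_mul, mul_assoc, mul_assoc, σ.bar_bar_mul_lam] }
  have hl : ∀ p p', B p (l p') = σ.bar (B p' p) * σ.lam := fun p p' => hf p' p
  -- B(l p, l p') applies the involution r ↦ bar r · λ twice to B(p, p').
  have h₁ : h.adjoint l * l = 1 := h.end_ext fun p p' => by
    rw [Module.End.mul_apply, h.form_adjoint, hl, hl, Module.End.one_apply, σ.bar_mul_lam_twice]
  -- A left inverse alone does not make l a unit. A preimage z of p' has to satisfy bar B(z, p) · λ
  -- = B(p, p') for all p; solving for B(z, p) gives a linear form, which nondegeneracy represents.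
  have hsurj : Function.Surjective l := fun p' => by
    obtain ⟨z, hz⟩ := h.bijective.2
      { toFun := fun p => σ.barInv (B p p' * σ.bar σ.lam)
        map_add' := fun x y => by
          rw [map_add, AddMonoidHom.add_apply, add_mul, map_add]
        map_smul' := fun r x => by
          apply σ.bar_injective
          rw [← op_unop r, h.sesquilinear.op_smul, RingHom.id_apply, op_smul_eq_mul, σ.bar_mul,
            σ.bar_barInv, σ.bar_barInv, mul_assoc] }
    refine ⟨z, h.right_separating fun p => ?_⟩
    have hz' : B z p = σ.barInv (B p p' * σ.bar σ.lam) := DFunLike.congr_fun hz p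
    rw [hl, hz', σ.bar_barInv, mul_assoc, σ.bar_lam_mul_lam, mul_one]
  have h₂ : l * h.adjoint l = 1 := LinearMap.ext fun p => by
    obtain ⟨z, rfl⟩ := hsurj p
    exact congrArg l (DFunLike.congr_fun h₁ z)
  exact ⟨⟨l, h.adjoint l, h₂, h₁⟩, hl⟩

/-- The symmetry of `B`. -/
noncomputable def symmetry : (Module.End Rᵐᵒᵖ P)ˣ := h.exists_symmetry.choose

theorem form_symmetry (p p' : P) : B p (h.symmetry.1 p') = σ.bar (B p' p) * σ.lam :=
  h.exists_symmetry.choose_spec p p'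

end IsNondegenerate

end Sesquilinear

/-! ### The quadratic algebra of endomorphisms and the twisted actions on P -/

section EndStructure

variable {K : Type v} {AK : Type w} [CommRing K] [StarRing K] [CommRing AK] [QuadraticRing K AK]
  {R : QuadAlg.{u} K AK} {P : Type u} [AddCommGroup P] [Module (R : Type u)ᵐᵒᵖ P]
  {B : P →+ P →+ R} (h : IsNondegenerate R.str.inv B)

attribute [local instance] endAlgebra

namespace IsNondegenerate

/-- The pseudo-involution on `End_R(P)` given by a nondegenerate form. -/
noncomputable def endInvolution : PseudoInvolution K (Module.End (R : Type u)ᵐᵒᵖ P) where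
  bar := AddMonoidHom.mk' h.adjoint fun s s' => h.end_ext fun p p' => by
    rw [h.form_adjoint, LinearMap.add_apply, LinearMap.add_apply, map_add, map_add,
      AddMonoidHom.add_apply, h.form_adjoint, h.form_adjoint]
  lam := h.symmetry
  bar_one := h.end_ext fun p p' => h.form_adjoint _ _ _
  bar_mul s s' := h.end_ext fun p p' => by
    change B p (h.adjoint (s * s') p') = B p (h.adjoint s' (h.adjoint s p'))
    rw [h.form_adjoint, h.form_adjoint, h.form_adjoint]; rfl
  bar_bar s := by
    -- The symmetry exchanges the arguments of B. After the exchange the two adjoints are moved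
    -- across in turn.
    have e : ∀ t, h.adjoint (h.adjoint t) * h.symmetry.1 = h.symmetry.1 * t := fun t =>
      h.end_ext fun p p' => by
        rw [Module.End.mul_apply, Module.End.mul_apply, h.form_adjoint, h.form_symmetry,
          h.form_symmetry, h.form_adjoint]
    have e' : h.symmetry.1 * h.adjoint h.symmetry.1 = 1 := by
      have e'' : h.adjoint h.symmetry.1 * h.symmetry.1 = 1 := h.end_ext fun p p' => by
        rw [Module.End.mul_apply, h.form_adjoint, h.form_symmetry, h.form_symmetry,
          R.str.inv.bar_mul_lam_twice, Module.End.one_apply]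
      rw [Units.eq_inv_of_mul_eq_one_right e'', Units.mul_inv]
    change h.adjoint (h.adjoint s) = h.symmetry.1 * s * h.adjoint h.symmetry.1
    rw [← e, mul_assoc, e', mul_one]
  bar_algebraMap k := h.end_ext fun p p' => by
    refine (h.form_adjoint _ _ _).trans ?_
    change B (op (algebraMap K R k) • p) p' = B p (op (algebraMap K R (star k)) • p')
    rw [h.sesquilinear.op_smul, h.sesquilinear.smul_right, R.str.inv.bar_algebraMap,
      Algebra.commutes]

theorem endHermitian : IsHermitian h.endInvolution R.str.inv B where
  sesquilinear := h.sesquilinear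
  smul_left s p p' := (h.form_adjoint s p p').symm
  symm p p' := h.form_symmetry p p'

/-- The quadratic structure on `End_R(P)` consisting of all quadratic forms on `P`. -/
noncomputable def endStructure : EndQuadraticStructure B :=
  letI := quadraticForms.module h.endHermitian fun _ _ => rfl
  { A := quadraticForms h.endInvolution B
    str := quadraticForms.str h.endHermitian fun _ _ => rfl
    q := fun t p => t.1.2 p
    herm := h.endHermitian
    quad := quadraticForms.isQuadraticForm h.endHermitian fun _ _ => rfl }

/-- The pairing `P × P → R` with `bar (pairing q p) = B(p, q)`. -/
def pairing (_ : IsNondegenerate R.str.inv B) (q p : P) : R := R.str.inv.barInv (B p q)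

theorem bar_pairing (q p : P) : R.bar (h.pairing q p) = B p q := R.str.inv.bar_barInv _

theorem pairing_add (q p p' : P) : h.pairing q (p + p') = h.pairing q p + h.pairing q p' := by
  simp [pairing]

theorem add_pairing (q q' p : P) : h.pairing (q + q') p = h.pairing q p + h.pairing q' p := by
  simp [pairing]

theorem pairing_smul (q p : P) (r : R) : h.pairing q (op r • p) = h.pairing q p * r :=
  R.str.inv.bar_injective <| by
    rw [R.str.inv.bar_mul]
    refine (h.bar_pairing _ _).trans ((h.sesquilinear.op_smul _ _ _).trans ?_)
    exact congrArg _ (h.bar_pairing _ _).symm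

theorem smul_pairing (q p : P) (r : R) : h.pairing (op (R.bar r) • q) p = r * h.pairing q p :=
  R.str.inv.bar_injective <| by
    rw [R.str.inv.bar_mul]
    refine (h.bar_pairing _ _).trans ((h.sesquilinear.smul_right _ _ _).trans ?_)
    exact congrArg (· * R.bar r) (h.bar_pairing _ _).symm

theorem adjoint_pairing (s : Module.End (R : Type u)ᵐᵒᵖ P) (q p : P) :
    h.pairing (h.adjoint s q) p = h.pairing q (s p) := by
  rw [pairing, h.form_adjoint, pairing]

/-- The form `q, q' ↦ (p ↦ q pairing(q', p))` with values in `End_R(P)`. -/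
def dualForm : P →+ P →+ Module.End (R : Type u)ᵐᵒᵖ P :=
  AddMonoidHom.mk' (fun q => AddMonoidHom.mk' (fun q' =>
      { toFun := fun p => op (h.pairing q' p) • q
        map_add' := fun p p' => by rw [h.pairing_add, MulOpposite.op_add, add_smul]
        map_smul' := fun r p => by
          rw [← op_unop r, h.pairing_smul, MulOpposite.op_mul, mul_smul]; rfl })
      fun q' q'' => LinearMap.ext fun p => by
        change op (h.pairing (q' + q'') p) • q = _
        rw [h.add_pairing, MulOpposite.op_add, add_smul]; rfl)
    fun q q' => AddMonoidHom.ext fun q'' => LinearMap.ext fun p => smul_add _ q q'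

theorem dualForm_apply (q q' p : P) : h.dualForm q q' p = op (h.pairing q' p) • q := rfl

/-- This is the isometry condition for the pairing. As endomorphisms are determined by their values
under B, it leaves no other choice for the form on the dual. -/
theorem form_dualForm (q q' p p' : P) :
    B p (h.dualForm q q' p') = R.bar (h.pairing q p) * h.pairing q' p' := by
  rw [dualForm_apply, h.sesquilinear.smul_right, h.bar_pairing]

/-- `P` as a left `R`-module by `r * p = p (bar r)`. -/
@[reducible]
def dualLeft (R : QuadAlg.{u} K AK) (P : Type u) [AddCommGroup P] [Module (R : Type u)ᵐᵒᵖ P] :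
    Module R P :=
  letI : SMul R P := ⟨fun r p => op (R.bar r) • p⟩
  Module.ofMinimalAxioms (fun r p p' => smul_add (op (R.bar r)) p p')
    (fun r r' p => by
      change op (R.bar (r + r')) • p = op (R.bar r) • p + op (R.bar r') • p
      rw [map_add, MulOpposite.op_add, add_smul])
    (fun r r' p => by
      change op (R.bar (r * r')) • p = op (R.bar r) • op (R.bar r') • p
      rw [QuadAlg.bar, R.str.inv.bar_mul, MulOpposite.op_mul, mul_smul])
    (fun p => by
      change op (R.bar 1) • p = p
      rw [QuadAlg.bar, R.str.inv.bar_one, MulOpposite.op_one, one_smul])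

/-- `P` as a right `End_R(P)`-module by `p * s = bar s p`. -/
@[reducible]
noncomputable def dualRight : Module (Module.End (R : Type u)ᵐᵒᵖ P)ᵐᵒᵖ P :=
  letI : SMul (Module.End (R : Type u)ᵐᵒᵖ P)ᵐᵒᵖ P := ⟨fun s p => h.endInvolution.bar s.unop p⟩
  Module.ofMinimalAxioms (fun s p p' => map_add (h.endInvolution.bar s.unop) p p')
    (fun s s' p => by
      change h.endInvolution.bar (s.unop + s'.unop) p = _
      rw [map_add]; rfl)
    (fun s s' p => by
      change h.endInvolution.bar (s'.unop * s.unop) p = _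
      rw [h.endInvolution.bar_mul]; rfl)
    (fun p => by
      change h.endInvolution.bar 1 p = _
      rw [h.endInvolution.bar_one]; rfl)

end IsNondegenerate

end EndStructure

/-! ### Dualities from an isometric counit and a dual basis -/

section OfCounit

variable {K : Type v} {AK : Type w} [CommRing K] [StarRing K] [CommRing AK] [QuadraticRing K AK]
  {S R : QuadAlg.{u} K AK}

namespace QuadBimod

variable {P : QuadBimod S R} {Q : QuadBimod R S}

/-- A duality from a counit and a dual basis, for a full bimodule `P` on which elements of `S` and of
its quadratic structure are determined by their effect. -/
def Duality.ofCounit (ε : Isometry (Q.tensor P) (one R)) (x : P.tensor Q) (full : P.Full)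
    (sep : P.RightSeparating) (smul_ext : ∀ s s' : S, (∀ p : P, s • p = s' • p) → s = s')
    (quadratic_ext : ∀ a b : S.A, S.tr a = S.tr b → (∀ p, P.q a p = P.q b p) → a = b)
    (apply_unit : ∀ p : P, apply ε x p = p)
    (contract_unit : ∀ q : Q, contract (pairLinear ε q) Q x = q) : Duality P Q :=
  have eq_smul : ∀ y : P.tensor Q, ∃ s : S, y = s • x := fun y => by
    induction y using tmul_induction with
    | tmul p q =>
      obtain ⟨s, hs⟩ := full (applyLinear ε (tmul p q))
      exact ⟨s, by rw [← tmul_contract_pairLinear ε p q x s fun p' => (hs p').symm, contract_unit]⟩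
    | add y z hy hz =>
      obtain ⟨s, rfl⟩ := hy
      obtain ⟨s', rfl⟩ := hz
      exact ⟨s + s', (add_smul _ _ _).symm⟩
  -- The unit s ↦ s x is a bimodule map only if x commutes with S. As x s is some s' x, comparing
  -- the actions on P gives s' = s.
  have comm : ∀ s : S, op s • x = s • x := fun s => by
    obtain ⟨s', hs'⟩ := eq_smul (op s • x)
    have e : s = s' := smul_ext _ _ fun p => by
      have := congrArg (fun y => apply ε y p) hs'
      simpa only [apply_op_smul, apply_smul_left, apply_unit] using this
    rw [hs', e]
  -- That the unit is an isometry is automatic: by `form_apply` the identity can be tested on P,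
  -- where x acts as the identity. The same holds for the quadratic form by `q_apply`.
  have form_eq : ∀ s s' : S, (P.tensor Q).form (s • x) (s' • x) = S.bar s * s' := fun s s' =>
    smul_ext _ _ fun p' => sep _ _ fun p => by
      rw [← form_apply ε, apply_smul_left, apply_smul_left, apply_unit, apply_unit,
        P.form_smul_left, mul_smul]
  { unit :=
      { hom := AddMonoidHom.mk' (fun s => one.val s • x)
          fun s s' => add_smul (one.val s) (one.val s') x
        map_smul_left := fun s s' => mul_smul s (one.val s') x
        map_smul_right := fun s s' => by
          change (one.val s' * s) • x = op s • one.val s' • x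
          rw [← smul_comm, comm, mul_smul]
        form_map := form_eq
        q_map := fun a s => by
          change (P.tensor Q).q a (one.val s • x) = S.act a (one.val s)
          refine quadratic_ext _ _ ?_ fun p => ?_
          · refine ((P.tensor Q).quad.tr_apply _ _).trans (Eq.trans ?_ (S.str.qs.tr_act _ _).symm)
            rw [smul_smul, form_eq, mul_assoc]
          · rw [q_apply ε, apply_smul_left, apply_unit]
            exact (P.quad.act_left _ _ _).symm }
    counit := ε
    apply_unit := fun p => by
      change apply ε ((1 : S) • x) p = p
      rw [one_smul, apply_unit]
    contract_unit := fun q => by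
      change contract (pairLinear ε q) Q ((1 : S) • x) = q
      rw [one_smul, contract_unit] }

end QuadBimod

end OfCounit

/-! ### The dual bimodule as left adjoint -/

section DualBimodule

variable {K : Type v} {AK : Type w} [CommRing K] [StarRing K] [CommRing AK] [QuadraticRing K AK]
  {R : QuadAlg.{u} K AK} {P : Type u} [AddCommGroup P] [Module (R : Type u)ᵐᵒᵖ P]
  {B : P →+ P →+ R} (h : IsNondegenerate R.str.inv B)

attribute [local instance] endAlgebra

namespace IsNondegenerate

theorem dualForm_smul_left (q q' : P) (r : R) :
    h.dualForm (op (R.bar r) • q) q' = h.dualForm q (op (R.bar (R.bar r)) • q') :=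
  h.end_ext fun p p' => by
    rw [form_dualForm, form_dualForm, h.smul_pairing, h.smul_pairing, QuadAlg.bar,
      R.str.inv.bar_mul, mul_assoc]

theorem dualForm_symm (q q' : P) :
    h.dualForm q (op (R.bar R.lam) • q') =
      h.endInvolution.bar (h.dualForm q' q) * h.endInvolution.lam :=
  h.end_ext fun p p' => by
    rw [form_dualForm, h.smul_pairing]
    refine Eq.trans ?_ (h.form_adjoint _ _ _).symm
    refine Eq.trans ?_ (h.form_symmetry _ _).symm
    rw [form_dualForm, R.str.inv.bar_mul, mul_assoc, R.str.inv.bar_bar_mul_lam]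

theorem dualForm_adjoint (q q' : P) (s s' : Module.End (R : Type u)ᵐᵒᵖ P) :
    h.dualForm (h.adjoint s q) (h.adjoint s' q') = h.adjoint s * h.dualForm q q' * s' :=
  h.end_ext fun p p' => by
    rw [form_dualForm, h.adjoint_pairing, h.adjoint_pairing, Module.End.mul_apply,
      Module.End.mul_apply, h.form_adjoint, form_dualForm]

theorem bar_dualForm (q q' : P) (r : R) :
    h.endInvolution.bar (h.dualForm q (op (R.bar r) • q')) * h.endInvolution.lam =
      h.dualForm q' (op (R.bar (R.bar r * R.lam)) • q) := by
  rw [← h.dualForm_symm, h.dualForm_smul_left, smul_smul, ← MulOpposite.op_mul, QuadAlg.bar,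
    ← R.str.inv.bar_mul]

/-- The symmetry of tr a carries over to the dual form. It makes the first component of `dualQ`
symmetric, and it accounts for the two cross terms in the polarization of `dualQ`. -/
theorem bar_dualForm_tr (a : R.A) (q q' : P) :
    h.endInvolution.bar (h.dualForm q (op (R.bar (R.tr a)) • q')) * h.endInvolution.lam =
      h.dualForm q' (op (R.bar (R.tr a)) • q) := by
  rw [bar_dualForm]
  exact congrArg (fun r => h.dualForm q' (op (R.bar r) • q)) (R.str.qs.tr_symm a).symm

/-- The values of the quadratic form on the dual bimodule. -/
noncomputable def dualQ (a : R.A) (q : P) : quadraticForms h.endInvolution B :=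
  ⟨(h.dualForm q (op (R.bar (R.tr a)) • q), fun p => R.act a (h.pairing q p)), by
    refine ⟨?_, fun p r => ?_, fun p p' => ?_, fun p => ?_⟩
    · exact (h.bar_dualForm_tr a q q).symm
    · change R.act a (h.pairing q (op r • p)) = _
      rw [h.pairing_smul]
      exact R.str.qs.act_mul _ _ _
    · change R.act a (h.pairing q (p + p')) = R.act a (h.pairing q p) + _ + R.act a (h.pairing q p')
      -- In `act_add` the conjugated factor of the cross term is the second summand, whereas the
      -- polarization has p in the conjugated place.
      rw [h.pairing_add, add_comm (h.pairing q p)]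
      refine (R.str.qs.act_add _ _ _).trans ?_
      change _ = R.act a (h.pairing q p) +
        R.phi (B p (h.dualForm q (op (R.bar (R.tr a)) • q) p')) + R.act a (h.pairing q p')
      rw [form_dualForm, h.smul_pairing, mul_assoc]
      abel
    · refine (R.str.qs.tr_act _ _).trans ?_
      change _ = B p (h.dualForm q _ p)
      rw [form_dualForm, h.smul_pairing, mul_assoc]⟩

/-- `P` with the dual actions as a hermitian bimodule. -/
noncomputable def dualHermBimod : HermBimod R h.endStructure.alg :=
  letI := dualLeft R P
  letI : Module (h.endStructure.alg : Type u)ᵐᵒᵖ P := h.dualRight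
  haveI : SMulCommClass R (h.endStructure.alg : Type u)ᵐᵒᵖ P :=
    ⟨fun r s p => (map_smul (h.endInvolution.bar s.unop) (op (R.bar r)) p).symm⟩
  { carrier := P
    central := fun k p => by
      change op (R.bar (algebraMap K R k)) • p =
        h.endInvolution.bar (algebraMap K (Module.End (R : Type u)ᵐᵒᵖ P) k) p
      rw [h.endInvolution.bar_algebraMap, QuadAlg.bar, R.str.inv.bar_algebraMap]
      rfl
    form := h.dualForm
    herm :=
      { sesquilinear := fun q q' s s' => h.dualForm_adjoint q q' s s'
        smul_left := fun r q q' => h.dualForm_smul_left q q' r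
        symm := fun q q' => h.dualForm_symm q q' } }

/-- The dual of `P` as a quadratic bimodule. -/
noncomputable def dualBimod : QuadBimod R h.endStructure.alg where
  toHermBimod := h.dualHermBimod
  q := h.dualQ
  quad :=
    { add_left := fun a a' (q : P) => quadraticForms.ext
        (by
          change h.dualForm q (op (R.bar (R.tr (a + a'))) • q) =
            h.dualForm q (op (R.bar (R.tr a)) • q) + h.dualForm q (op (R.bar (R.tr a')) • q)
          rw [map_add, map_add, MulOpposite.op_add, add_smul, map_add])
        (fun p => R.str.qs.add_act a a' (h.pairing q p))
      act_left := fun a r (q : P) => quadraticForms.ext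
        (by
          change h.dualForm q (op (R.bar (R.tr (R.act a r))) • q) =
            h.dualForm (op (R.bar r) • q) (op (R.bar (R.tr a)) • op (R.bar r) • q)
          rw [h.dualForm_smul_left, smul_smul, smul_smul, ← MulOpposite.op_mul,
            ← MulOpposite.op_mul]
          refine congrArg (fun r => h.dualForm q (op r • q)) ?_
          refine (congrArg R.bar (R.str.qs.tr_act a r)).trans ?_
          rw [R.str.inv.bar_mul, R.str.inv.bar_mul])
        (fun p => by
          change R.act (R.act a r) (h.pairing q p) = R.act a (h.pairing (op (R.bar r) • q) p)
          rw [h.smul_pairing]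
          exact (R.str.qs.act_mul _ _ _).symm)
      phi_left := fun r (q : P) => quadraticForms.ext
        (by
          change h.dualForm q (op (R.bar (R.tr (R.phi r))) • q) =
            h.dualForm q (op (R.bar r) • q) +
              h.endInvolution.bar (h.dualForm q (op (R.bar r) • q)) * h.endInvolution.lam
          rw [bar_dualForm, ← map_add, ← add_smul, ← MulOpposite.op_add, ← map_add]
          exact congrArg (fun r => h.dualForm q (op (R.bar r) • q)) (R.str.qs.tr_phi r))
        (fun p => by
          refine (R.str.qs.phi_act _ _).symm.trans (congrArg R.phi ?_)
          change _ = B p (h.dualForm q (op (R.bar r) • q) p)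
          rw [form_dualForm, h.smul_pairing, mul_assoc])
      smul_right := fun a (q : P) (s : Module.End (R : Type u)ᵐᵒᵖ P) => quadraticForms.ext
        (by
          change h.dualForm (h.adjoint s q) (op (R.bar (R.tr a)) • h.adjoint s q) =
            h.adjoint s * h.dualForm q (op (R.bar (R.tr a)) • q) * s
          rw [← map_smul, h.dualForm_adjoint])
        (fun p => congrArg (R.act a) (h.adjoint_pairing s q p))
      add_right := fun a (q q' : P) => quadraticForms.ext
        (by
          change h.dualForm (q + q') (op (R.bar (R.tr a)) • (q + q')) =
            h.dualForm q (op (R.bar (R.tr a)) • q) +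
            (h.dualForm q (op (R.bar (R.tr a)) • q') +
              h.endInvolution.bar (h.dualForm q (op (R.bar (R.tr a)) • q')) *
                h.endInvolution.lam) +
            h.dualForm q' (op (R.bar (R.tr a)) • q')
          rw [bar_dualForm_tr]
          simp only [smul_add, map_add, AddMonoidHom.add_apply]
          abel)
        (fun p => by
          change R.act a (h.pairing (q + q') p) = R.act a (h.pairing q p) +
            R.phi (B p (h.dualForm q (op (R.bar (R.tr a)) • q') p)) + R.act a (h.pairing q' p)
          rw [h.add_pairing, add_comm (h.pairing q p)]
          refine (R.str.qs.act_add _ _ _).trans ?_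
          rw [form_dualForm, h.smul_pairing, mul_assoc]
          abel)
      tr_apply := fun a q => rfl
      smul_left := fun c a (q : P) => quadraticForms.ext
        (h.end_ext fun p p' => by
          change B p (h.dualForm q (op (R.bar (R.tr (c • a))) • q) p') =
            B p ((_ • h.dualForm q (op (R.bar (R.tr a)) • q)) p')
          refine Eq.trans ?_ (h.endHermitian.form_algebra_smul (fun _ _ => rfl) _
            (h.dualForm q (op (R.bar (R.tr a)) • q)) p p').symm
          change _ = _ • B p (h.dualForm q (op (R.bar (R.tr a)) • q) p')
          rw [form_dualForm, form_dualForm, h.smul_pairing, h.smul_pairing, ← mul_smul_comm,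
            ← smul_mul_assoc]
          exact congrArg (fun r => R.bar (h.pairing q p) * (r * h.pairing q p'))
            (R.str.tr_smul c a))
        (fun p => (R.str.smul_act c a (h.pairing q p)).symm) }

open QuadBimod in
/-- The evaluation of the dual of `P` at `P`. -/
noncomputable def dualCounit : Isometry (h.dualBimod.tensor h.endStructure.bimod) (one R) :=
  Isometry.ofTensor (N := one R)
    (lift (fun q p => one.of (h.pairing q p)) (fun q q' p => h.add_pairing q q' p)
      (fun q p p' => h.pairing_add q p p') (fun q s p => h.adjoint_pairing s q p))
    (fun r q p => h.smul_pairing q p r)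
    (fun r q p => h.pairing_smul q p r)
    (fun q q' p p' => (h.form_dualForm q q' p p').symm)
    (fun _ _ _ => rfl)

-- A dual basis xᵢ, B(yᵢ, -) becomes a copairing ∑ xᵢ ⊗ qᵢ once each form B(yᵢ, -) is written as the
-- pairing with some qᵢ.
open QuadBimod in
theorem exists_dualCopair : ∃ x : h.endStructure.bimod.tensor h.dualBimod,
    ∀ p, apply h.dualCounit x p = p := by
  obtain ⟨n, x, y, hxy⟩ := h.exists_dual_basis
  have e : ∀ i, ∃ q : P, ∀ p, h.pairing q p = B (y i) p := fun i => by
    -- Conjugating the linear form B(yᵢ, -) gives an antilinear form, hence some B(-, q). The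
    -- pairing with q is the inverse conjugate of that, which is B(yᵢ, -) again.
    obtain ⟨q, hq⟩ := h.exists_form_eq
      (AddMonoidHom.mk' (fun p => R.bar (B (y i) p)) fun p p' => by simp) fun p r => by
        change R.bar (B (y i) (op r • p)) = _
        rw [h.sesquilinear.smul_right, QuadAlg.bar, R.str.inv.bar_mul]; rfl
    exact ⟨q, fun p => R.str.inv.bar_injective ((h.bar_pairing q p).trans (hq p))⟩
  choose q hq using e
  refine ⟨∑ i, tmul (L := h.endStructure.bimod) (M := h.dualBimod) (x i) (q i), fun p => ?_⟩
  rw [map_sum, AddMonoidHom.finsetSum_apply]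
  refine Eq.trans (Finset.sum_congr rfl fun i _ => ?_) (hxy p)
  exact congrArg (fun r => op r • x i) (hq i p)

open QuadBimod in
/-- The duality between `P` and its dual. -/
noncomputable def dualDuality : Duality h.endStructure.bimod h.dualBimod :=
  have hx := h.exists_dualCopair.choose_spec
  Duality.ofCounit h.dualCounit h.exists_dualCopair.choose (fun f => ⟨f, fun _ => rfl⟩)
    (fun _ _ hp => h.right_separating hp) (fun _ _ hs => LinearMap.ext hs)
    (fun _ _ ht hq => quadraticForms.ext ht hq) hx
    (fun q => h.right_separating fun p => by
      refine (h.bar_pairing _ _).symm.trans (Eq.trans ?_ (h.bar_pairing _ _))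
      refine congrArg R.bar ?_
      refine (pair_contract h.dualCounit (pairLinear h.dualCounit q) _ p).trans ?_
      exact congrArg (h.pairing q) (hx p))

theorem hasLeftAdjoint : h.endStructure.HasLeftAdjoint :=
  Bicategory.IsRightAdjoint.mk h.dualDuality.toAdjunction

end IsNondegenerate

end DualBimodule

/-! ### Uniqueness on endomorphism rings and the main theorem -/

section EndIso

variable {K : Type v} {AK : Type w} [CommRing K] [StarRing K] [CommRing AK] [QuadraticRing K AK]
  {R : QuadAlg.{u} K AK} {P : Type u} [AddCommGroup P] [Module (R : Type u)ᵐᵒᵖ P]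
  {B : P →+ P →+ R}

attribute [local instance] endAlgebra

open QuadBimod

theorem EndQuadraticStructure.bimod_full (X : EndQuadraticStructure B) : X.bimod.Full :=
  fun f => ⟨f, fun _ => rfl⟩

/-- The identity of P preserves B, and B determines adjoints and the symmetry, so it is a hermitian
isomorphism over the identity of End(P). An isomorphism of quadratic algebras that is the identity
on End(P) includes the equality of the pseudo-involutions and of their symmetries. -/
theorem EndQuadraticStructure.existsUnique_iso (h : IsNondegenerate R.str.inv B)
    (X Y : EndQuadraticStructure B) (hX : X.HasLeftAdjoint) (hY : Y.HasLeftAdjoint) :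
    ∃! e : X.alg.Iso Y.alg,
      (∀ s : Module.End (R : Type u)ᵐᵒᵖ P, e.toAlgEquiv s = s) ∧
      ∀ (a : X.A) (p : P), Y.q (e.mapA a) p = X.q a p := by
  obtain ⟨⟨Q, adj⟩⟩ := hX
  obtain ⟨⟨Q', adj'⟩⟩ := hY
  let D := Duality.ofAdjunction adj
  let D' := Duality.ofAdjunction adj'
  let c : HermIso X.bimod Y.bimod := HermIso.ofSeparating D' (fun _ _ hp => h.right_separating hp)
    (AddEquiv.refl P) (AlgEquiv.refl (R := K) (A₁ := Module.End (R : Type u)ᵐᵒᵖ P))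
    (fun _ _ => rfl) (fun _ _ => rfl) (fun _ _ => rfl)
  exact ⟨c.algIso D D', ⟨fun _ => rfl, c.q_mapA D'⟩,
    fun e he => c.algIso_unique D D' he.1 he.2⟩

end EndIso

theorem mainTheorem5 {K : Type v} {AK : Type w} [CommRing K] [StarRing K] [CommRing AK]
    [QuadraticRing K AK] :
    (∀ (R : QuadAlg.{u} K AK) (P : Type u) [AddCommGroup P] [Module (R : Type u)ᵐᵒᵖ P]
      (B : P →+ P →+ R), IsNondegenerate R.str.inv B →
      (∃ X : EndQuadraticStructure B, X.HasLeftAdjoint) ∧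
      ∀ X Y : EndQuadraticStructure B, X.HasLeftAdjoint → Y.HasLeftAdjoint →
        ∃! e : X.alg.Iso Y.alg,
          (∀ s : Module.End (R : Type u)ᵐᵒᵖ P, e.toAlgEquiv s = s) ∧
          ∀ (a : X.A) (p : P), Y.q (e.mapA a) p = X.q a p) ∧
    (∀ (S R : QuadAlg.{u} K AK) (Q : QuadBimod R S) (P : QuadBimod S R)
      (adj : Bicategory.Adjunction (B := QuadAlg.{u} K AK) (a := S) (b := R) Q P),
      IsIso adj.unit → IsIso adj.counit →
      IsNondegenerate R.str.inv P.form ∧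
      IsFullyProjective R P ∧
      ∀ (X : EndQuadraticStructure P.form) (Q' : QuadBimod R X.alg)
        (adj' : Bicategory.Adjunction (B := QuadAlg.{u} K AK) (a := X.alg) (b := R) Q' X.bimod),
        IsIso adj'.unit ∧ IsIso adj'.counit ∧
        ∃! Φ : AdjunctionIso adj adj', ∀ p : P, Φ.right.equiv p = p) := by
  refine ⟨fun R P _ _ B h => ⟨⟨h.endStructure, h.hasLeftAdjoint⟩, fun X Y hX hY =>
    EndQuadraticStructure.existsUnique_iso h X Y hX hY⟩, fun S R Q P adj hu hc => ?_⟩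
  let D := QuadBimod.Duality.ofAdjunction adj
  have hη : Function.Surjective D.unit.hom :=
    @QuadBimod.surjective_of_isIso _ _ _ _ _ _ _ _ _ _ adj.unit hu
  have hε : Function.Surjective D.counit.hom :=
    @QuadBimod.surjective_of_isIso _ _ _ _ _ _ _ _ _ _ adj.counit hc
  have h := D.isNondegenerate hε
  refine ⟨h, D.isFullyProjective hε, fun X Q' adj' => ?_⟩
  let D' := QuadBimod.Duality.ofAdjunction adj'
  have sep : X.bimod.RightSeparating := fun _ _ hp => h.right_separating hp
  have full : P.Full := D.full_of_surjective hη
  let e : P ≃+ X.bimod := AddEquiv.refl P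
  -- Both S and End(P) give all endomorphisms of P and act faithfully, so the identity of P induces
  -- an isomorphism of rings. Nondegeneracy makes it compatible with the pseudo-involutions.
  let c : QuadBimod.HermIso P X.bimod := QuadBimod.HermIso.ofSeparating D' sep e
    (QuadBimod.HermIso.algOfFull D D' full X.bimod_full e fun _ _ => rfl)
    (QuadBimod.HermIso.algOfFull_smul D D' full X.bimod_full e fun _ _ => rfl)
    (fun _ _ => rfl) (fun _ _ => rfl)
  refine ⟨QuadBimod.isIso_of_bijective _ (D'.unit_bijective X.bimod_full),
    QuadBimod.isIso_of_bijective _ (D'.counit_bijective X.bimod_full ?_),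
    QuadBimod.existsUnique_adjunctionIso adj adj' c sep X.bimod_full⟩
  -- The remaining condition is that 1 lies in the image of the second counit. A preimage under the
  -- first counit is carried over by the comparison of Q ⊗ P with Q' ⊗ P, which preserves the
  -- counits.
  obtain ⟨x, hx⟩ := hε (QuadBimod.one.of 1)
  exact ⟨(c.dualIso D D' sep).tensorMap (c.rightIso D D') x,
    (c.counit_tensorMap D D' sep x).trans hx⟩
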